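/- Let $X(t)$, $t\in\mathbb R$, be a real-valued, centred, mean square continuous, stationary Gaussian process (with jointly measurable $(t,\cdot)\mapsto X(t)$), with covariance function $B(\tau)=\mathbf E X(t+\tau)X(t)=\int_{-\infty}^{\infty}e^{i\tau\lambda}\,dF(\lambda)$, where $F$ is the (finite) spectral measure of $X$. Let $0<\Lambda<\omega$, $T>0$, $p\ge 1$, $\varepsilon>0$, $0<\delta<1$, $z\in(0,1)$, and let $n$ be a natural number with $n\ge \frac{\omega T}{\pi\sqrt z}$. Put \[X_n(t)=\sum_{k=-n}^{n}\frac{\sin\left(\omega\left(t-\frac{k\pi}{\omega}\right)\right)}{\omega\left(t-\frac{k\pi}{\omega}\right)}\,X\!\left(\frac{k\pi}{\omega}\right)\] (with $\frac{\sin 0}{0}:=1$), $\mathrm{Si}(\pi)=\int_0^\pi\frac{\sin u}{u}\,du$, and, for $t\in[0,T]$, \[A_n(t,\Lambda)=\frac{\sqrt{C_n(t,\Lambda)}}{n}+D_n(t)\left(\int_{|\lambda|>\Lambda}dF(\lambda)\right)^{1/2},\] \[C_n(t,\Lambda)=B(0)\left(\frac{4\omega t}{\pi^2(1-z)}+\frac{4\left(z+1+\frac1n\right)}{\pi(1-z)^2\left(1-\frac{\Lambda}{\omega}\right)}\right)^2,\]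 \[D_n(t)=2+\frac{2|\sin(\omega t)|}{\pi}\left(1+\mathrm{Si}(\pi)+\frac{\frac{\omega t}{\pi}+\frac12}{n-\frac{\omega t}{\pi}}\right).\] If \[\hat S_{n,p}:=\int_0^T A_n(t,\Lambda)^p\,dt<\frac{\varepsilon}{\max\left(p^{p/2},\,(2\ln(2/\delta))^{p/2}\right)},\] then $X_n$ approximates $X$ in $L_p([0,T])$ with accuracy $\varepsilon$ and reliability $1-\delta$; that is, $\int_0^T|X(t)-X_n(t)|^p\,dt$ exists with probability $1$ and \[\mathbf P\left\{\int_0^T|X(t)-X_n(t)|^p\,dt>\varepsilon\right\}\le\delta.\] -/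

import Mathlib

open MeasureTheory ProbabilityTheory Filter Topology

noncomputable section

namespace SincApprox

/-- A real-valued, centred, mean square continuous random process on the line that is stationary:
its second moments are finite and are invariant under shifts of time. -/
structure IsStationaryProcess {Ω : Type*} [MeasurableSpace Ω] (P : Measure Ω)
    (X : ℝ → Ω → ℝ) : Prop where
  memLp_two : ∀ t, MemLp (X t) 2 P
  mean_zero : ∀ t, ∫ w, X t w ∂P = 0
  shift_invariant : ∀ s t h, ∫ w, X (s + h) w * X (t + h) w ∂P = ∫ w, X s w * X t w ∂P
  meanSquare_continuous : ∀ t₀, Tendsto (fun t => ∫ w, (X t w - X t₀ w) ^ 2 ∂P) (𝓝 t₀) (𝓝 0)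

/-- The covariance function `B(τ) = E X(τ) X(0)` of a stationary process; by stationarity it is
`E X(t + τ) X(t)` for every `t`. -/
def covFun {Ω : Type*} [MeasurableSpace Ω] (P : Measure Ω) (X : ℝ → Ω → ℝ) (τ : ℝ) : ℝ :=
  ∫ w, X τ w * X 0 w ∂P

/-- `F` is the spectral measure of the process: `B(τ) = ∫ exp(i τ l) dF(l)` for all real `τ`. -/
def IsSpectralMeasure {Ω : Type*} [MeasurableSpace Ω] (P : Measure Ω) (X : ℝ → Ω → ℝ)
    (F : Measure ℝ) : Prop :=
  IsFiniteMeasure F ∧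
    ∀ τ : ℝ, (covFun P X τ : ℂ) = ∫ l : ℝ, Complex.exp (Complex.I * (τ : ℂ) * (l : ℂ)) ∂F

/-- The truncated Whittaker-Kotel'nikov-Shannon series
`∑_{k=-n}^n sin(ω(t - kπ/ω)) / (ω(t - kπ/ω)) · X(kπ/ω)`; `Real.sinc x` is `sin x / x`, and `1`
at `x = 0`. -/
def truncatedSeries {Ω : Type*} (ω : ℝ) (n : ℕ) (X : ℝ → Ω → ℝ) (t : ℝ) (w : Ω) : ℝ :=
  ∑ k ∈ Finset.Icc (-(n : ℤ)) (n : ℤ),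
    Real.sinc (ω * (t - (k : ℝ) * Real.pi / ω)) * X ((k : ℝ) * Real.pi / ω) w

/-- The sine integral. -/
def Si (x : ℝ) : ℝ := ∫ u in (0 : ℝ)..x, Real.sin u / u

/-- `C_n(t, Λ)`, where `B0` is the variance `B(0)`. -/
def Cn (B0 ω Λ z : ℝ) (n : ℕ) (t : ℝ) : ℝ :=
  B0 * (4 * ω * t / (Real.pi ^ 2 * (1 - z))
    + 4 * (z + 1 + 1 / (n : ℝ)) / (Real.pi * (1 - z) ^ 2 * (1 - Λ / ω))) ^ 2

/-- `D_n(t)`. -/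
def Dn (ω : ℝ) (n : ℕ) (t : ℝ) : ℝ :=
  2 + 2 * |Real.sin (ω * t)| / Real.pi *
    (1 + Si Real.pi + (ω * t / Real.pi + 1 / 2) / ((n : ℝ) - ω * t / Real.pi))

/-- `A_n(t, Λ)`, the mean square bound, where `F` is the spectral measure. -/
def An (B0 : ℝ) (F : Measure ℝ) (ω Λ z : ℝ) (n : ℕ) (t : ℝ) : ℝ :=
  Real.sqrt (Cn B0 ω Λ z n t) / (n : ℝ) + Dn ω n t * Real.sqrt (F.real {l : ℝ | Λ < |l|})

/-- `Ŝ_{n,p} = ∫_0^T A_n(t, Λ)^p dt`. -/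
def Snp (B0 : ℝ) (F : Measure ℝ) (ω Λ z : ℝ) (n : ℕ) (p T : ℝ) : ℝ :=
  ∫ t in (0 : ℝ)..T, An B0 F ω Λ z n t ^ p

/-- `Y` approximates `X` in `L_p([0,T])` with accuracy `ε` and reliability `1 - δ`: the integral
`∫_0^T |X(t) - Y(t)|^p dt` exists with probability one, and it exceeds `ε` with probability at
most `δ`. -/
def ApproximatesInLp {Ω : Type*} [MeasurableSpace Ω] (P : Measure Ω) (X Y : ℝ → Ω → ℝ)
    (p T ε δ : ℝ) : Prop :=
  (∀ᵐ w ∂P, IntervalIntegrable (fun t => |X t w - Y t w| ^ p) volume 0 T) ∧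
    P.real {w | ε < ∫ t in (0 : ℝ)..T, |X t w - Y t w| ^ p} ≤ δ

end SincApprox

end

/-! The error `X t - X_n t` is a finite linear combination of values of the process, so it is a
centred Gaussian variable. The theorem follows from a bound on its variance together with a tail
estimate that uses only Gaussian moments.

Variance. By `integral_sq_sum_eq_integral_norm_sq` the second moment of the error is the integral
against `F` of `|exp(iay) - sincSum a n y|^2`, with `a = ωt/π` and `y = πl/ω`. Two deterministic
estimates control the integrand. For `|l| ≤ Λ` one has `|y| < π`, the cardinal series of `exp(iay)`
converges to it (`tendsto_sincSum`), and Abel summation of the alternating tail gives an error of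
order `1/n` (`norm_exp_sub_sincSum_le`). For all other frequencies only boundedness is used
(`norm_sincSum_le`): centring the sum at the integer nearest to `a` and pairing opposite indices
reduces it to sawtooth partial sums, which the Gibbs constant `Si π` bounds (`abs_sinSum_le`).
Splitting the spectral integral at `Λ` then gives the bound `A_n^2` (`integral_sq_error_le`).

Tail. With `M = max(p, 2 ln(2/δ))` and `u = M/p ≥ 1`, Jensen's inequality with weight `A^p` bounds
the `u`-th moment of `∫ |Z|^p` by `S^u` times the bound `2 M^(M/2) exp(-M/2)` for the `M`-th
absolute Gaussian moment, where `S = ∫ A^p`. Markov's inequality finishes: the hypothesis on `S`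
cancels `M^(M/2)`, and `2 exp(-M/2) ≤ δ` by the choice of `M` (`gaussian_integral_rpow_tail`). -/

namespace SincApprox

/-! ### The sine integral and the Gibbs bound for sawtooth partial sums. -/

open Real in
lemma antitoneOn_sinc : AntitoneOn sinc (Set.Icc 0 π) := by
  intro x hx y hy hxy
  rcases hx.1.eq_or_lt with h0 | h0
  · rw [← h0, sinc_zero]; exact sinc_le_one y
  have hy0 : 0 < y := h0.trans_le hxy
  -- Concavity of the sine on `[0, π]`: the chord slope from the origin decreases.
  rw [sinc_of_ne_zero h0.ne', sinc_of_ne_zero hy0.ne', div_le_div_iff₀ hy0 h0]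
  have hc := strictConcaveOn_sin_Icc.concaveOn.2
  have h := hc (Set.left_mem_Icc.2 pi_pos.le) hy
    (a := 1 - x / y) (b := x / y) (by rw [sub_nonneg, div_le_one hy0]; exact hxy)
    (by positivity) (by ring)
  simp only [smul_eq_mul, mul_zero, zero_add, sin_zero, div_mul_cancel₀ _ hy0.ne'] at h
  rw [div_mul_eq_mul_div, div_le_iff₀ hy0] at h
  linarith

lemma Si_eq_integral_sinc (x : ℝ) (hx : 0 ≤ x) : Si x = ∫ u in (0 : ℝ)..x, Real.sinc u := by
  refine intervalIntegral.integral_congr_uIoo fun u hu => ?_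
  rw [Set.uIoo_of_le hx] at hu
  exact (Real.sinc_of_ne_zero hu.1.ne').symm

open Real in
lemma sinc_nonneg_of_mem {x : ℝ} (hx : x ∈ Set.Icc 0 π) : 0 ≤ sinc x := by
  refine le_trans (le_of_eq ?_) (antitoneOn_sinc hx (Set.right_mem_Icc.2 pi_pos.le) hx.2)
  simp [sinc_of_ne_zero pi_ne_zero]

-- The inequality `u/2 ≤ tan(u/2)` says that `sinc u ≥ cos(u/2)^2 = (1 + cos u)/2`, and the last
-- function has integral `π/2` over `[0, π]`.
open Real in
lemma pi_div_two_le_Si_pi : π / 2 ≤ Si π := by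
  rw [Si_eq_integral_sinc _ pi_pos.le]
  have h : ∫ u in (0 : ℝ)..π, (1 + cos u) / 2 = π / 2 := by
    rw [intervalIntegral.integral_div, intervalIntegral.integral_add (by simp) (by simp)]
    simp
  rw [← h]
  refine intervalIntegral.integral_mono_on pi_pos.le
    (Continuous.intervalIntegrable (by fun_prop) _ _)
    (continuous_sinc.intervalIntegrable _ _) fun u hu => ?_
  rcases hu.1.eq_or_lt with h0 | h0
  · rw [← h0]; simp
  rw [sinc_of_ne_zero h0.ne', le_div_iff₀ h0]
  have e1 : sin u = 2 * sin (u / 2) * cos (u / 2) := by rw [← sin_two_mul]; ring_nf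
  have e2 : (1 + cos u) / 2 = cos (u / 2) ^ 2 := by
    have := cos_two_mul (u / 2)
    rw [mul_div_cancel₀ _ (two_ne_zero)] at this
    rw [this]; ring
  rw [e1, e2]
  rcases hu.2.eq_or_lt with hp | hp
  · rw [hp]; simp
  have hc : 0 < cos (u / 2) := cos_pos_of_mem_Ioo ⟨by linarith, by linarith⟩
  have ht := le_tan (x := u / 2) (by linarith) (by linarith)
  rw [tan_eq_sin_div_cos, le_div_iff₀ hc] at ht
  nlinarith

/-- The partial sums of the Fourier series of the sawtooth function. -/
noncomputable def sinSum (N : ℕ) (x : ℝ) : ℝ :=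
  ∑ j ∈ Finset.range N, Real.sin ((j + 1) * x) / (j + 1)

-- The sum is a right-endpoint Riemann sum, with step `x`, of the function `sinc`, which decreases
-- on `[0, π]`. It is therefore at most the integral up to `N x`, and `sinc` is nonnegative on the
-- rest of `[0, π]`.
open Real in
lemma sinSum_le_of_mul_le_pi {N : ℕ} {x : ℝ} (hx : 0 ≤ x) (hN : N * x ≤ π) :
    sinSum N x ≤ Si π := by
  rcases hx.eq_or_lt with h0 | h0
  · rw [← h0]
    simpa [sinSum] using (by linarith [pi_div_two_le_Si_pi, pi_pos] : 0 ≤ Si π)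
  have ha : AntitoneOn (fun u => sinc (x * u)) (Set.Icc (0 : ℝ) (0 + N)) := by
    intro u hu v hv huv
    have hm : ∀ w ∈ Set.Icc (0 : ℝ) (0 + N), x * w ∈ Set.Icc 0 π := fun w hw =>
      ⟨mul_nonneg hx hw.1, le_trans (by nlinarith [hw.2]) hN⟩
    exact antitoneOn_sinc (hm u hu) (hm v hv) (by gcongr)
  have h := ha.sum_le_integral
  have e : sinSum N x = x * ∑ i ∈ Finset.range N, sinc (x * (0 + ((i + 1 : ℕ) : ℝ))) := by
    rw [sinSum, Finset.mul_sum]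
    refine Finset.sum_congr rfl fun i _ => ?_
    have : (i : ℝ) + 1 ≠ 0 := by positivity
    rw [sinc_of_ne_zero (by push_cast; rw [zero_add]; positivity)]
    push_cast
    rw [zero_add, mul_comm x]
    field_simp
  rw [e]
  refine (mul_le_mul_of_nonneg_left h hx).trans ?_
  rw [intervalIntegral.mul_integral_comp_mul_left, Si_eq_integral_sinc _ pi_pos.le]
  simp only [mul_zero, zero_add]
  have hNx : 0 ≤ x * N := by positivity
  rw [← intervalIntegral.integral_add_adjacent_intervals (b := x * N)
    (continuous_sinc.intervalIntegrable 0 _) (continuous_sinc.intervalIntegrable _ π)]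
  have : 0 ≤ ∫ u in (x * N)..π, sinc u :=
    intervalIntegral.integral_nonneg (by linarith [mul_comm x (N : ℝ)]) fun u hu =>
      sinc_nonneg_of_mem ⟨hNx.trans hu.1, hu.2⟩
  linarith

open Real in
lemma sinSum_nonneg_of_mul_le_pi {N : ℕ} {x : ℝ} (hx : 0 ≤ x) (hN : N * x ≤ π) :
    0 ≤ sinSum N x := by
  refine Finset.sum_nonneg fun j hj => div_nonneg (sin_nonneg_of_nonneg_of_le_pi (by positivity) ?_)
    (by positivity)
  have : ((j : ℝ) + 1) ≤ N := by exact_mod_cast Finset.mem_range.1 hj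
  exact le_trans (by gcongr) hN

open Real in
lemma two_sin_mul_dirichlet (N : ℕ) (x : ℝ) :
    2 * sin (x / 2) * (1 / 2 + ∑ j ∈ Finset.range N, cos ((j + 1) * x))
      = sin ((N + 1 / 2) * x) := by
  induction N with
  | zero => simp; ring_nf
  | succ k ih =>
    rw [Finset.sum_range_succ, ← add_assoc, mul_add, ih]
    push_cast
    have h1 : ((k : ℝ) + 1 + 1 / 2) * x = (k + 1) * x + x / 2 := by ring
    have h2 : ((k : ℝ) + 1 / 2) * x = (k + 1) * x - x / 2 := by ring
    rw [h1, h2, sin_add, sin_sub]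
    ring

lemma hasDerivAt_sinSum (N : ℕ) (x : ℝ) :
    HasDerivAt (sinSum N) (∑ j ∈ Finset.range N, Real.cos ((j + 1) * x)) x := by
  unfold sinSum
  refine HasDerivAt.fun_sum fun j _ => ?_
  have h := (((hasDerivAt_id x).const_mul ((j : ℝ) + 1)).sin).div_const ((j : ℝ) + 1)
  refine h.congr_deriv ?_
  have : (j : ℝ) + 1 ≠ 0 := by positivity
  simp only [id, mul_one]
  field_simp

/-- The auxiliary function whose monotonicity (`s = 1`: decreasing, `s = -1`: increasing) locates
the extrema of the partial sums. -/
noncomputable def sinSumAux (s : ℝ) (N : ℕ) (x : ℝ) : ℝ :=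
  sinSum N x + x / 2 +
    (s + Real.cos ((N + 1 / 2) * x)) * ((N + 1 / 2) * (2 * Real.sin (x / 2)))⁻¹

-- `sinSum N x + x/2` has the oscillating derivative `sin((N + 1/2)x) / (2 sin(x/2))`. The last term
-- of the auxiliary function cancels it, as in an integration by parts, and what remains has
-- constant sign on `(0, π)` when `s` is `1` or `-1`.
open Real in
lemma hasDerivAt_sinSumAux (s : ℝ) (N : ℕ) {x : ℝ} (hx : sin (x / 2) ≠ 0) :
    HasDerivAt (sinSumAux s N)
      (-(s + cos ((N + 1 / 2) * x)) * (cos (x / 2) / (4 * (N + 1 / 2) * sin (x / 2) ^ 2))) x := by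
  have hM : (N : ℝ) + 1 / 2 ≠ 0 := by positivity
  have h1 := (hasDerivAt_sinSum N x).add ((hasDerivAt_id x).div_const 2)
  have h2 := (((hasDerivAt_id x).const_mul ((N : ℝ) + 1 / 2)).cos).const_add s
  have h3 := ((((hasDerivAt_id x).div_const 2).sin).const_mul (2 : ℝ)).const_mul ((N : ℝ) + 1 / 2)
  have h4 := h3.inv (by simp only [id]; positivity)
  have h := h1.add (h2.mul h4)
  refine h.congr_deriv ?_
  have hd : 1 / 2 + ∑ j ∈ Finset.range N, cos ((j + 1) * x) =
      sin ((N + 1 / 2) * x) / (2 * sin (x / 2)) := by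
    rw [eq_div_iff (by positivity), mul_comm, two_sin_mul_dirichlet]
  rw [add_comm (∑ j ∈ Finset.range N, cos ((j + 1) * x)), hd]
  simp only [id, Pi.inv_apply]
  field_simp
  ring

open Real in
lemma sin_half_pos {x : ℝ} (h0 : 0 < x) (h1 : x ≤ π) : 0 < sin (x / 2) :=
  sin_pos_of_pos_of_lt_pi (by linarith) (by linarith [pi_pos])

open Real in
lemma sinSumAux_antitoneOn (N : ℕ) : AntitoneOn (sinSumAux 1 N) (Set.Ioc 0 π) := by
  refine antitoneOn_of_deriv_nonpos (convex_Ioc _ _) ?_ ?_ ?_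
  · exact fun x hx => (hasDerivAt_sinSumAux 1 N
      (sin_half_pos hx.1 hx.2).ne').continuousAt.continuousWithinAt
  · rw [interior_Ioc]
    exact fun x hx => (hasDerivAt_sinSumAux 1 N
      (sin_half_pos hx.1 hx.2.le).ne').differentiableAt.differentiableWithinAt
  · rw [interior_Ioc]
    intro x hx
    rw [(hasDerivAt_sinSumAux 1 N (sin_half_pos hx.1 hx.2.le).ne').deriv, neg_mul]
    have := neg_one_le_cos ((N + 1 / 2) * x)
    have hc : 0 ≤ cos (x / 2) := cos_nonneg_of_mem_Icc ⟨by linarith [hx.1, pi_pos], by linarith [hx.2]⟩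
    have : 0 ≤ 1 + cos ((N + 1 / 2) * x) := by linarith
    rw [neg_nonpos]
    positivity

open Real in
lemma sinSumAux_monotoneOn (N : ℕ) : MonotoneOn (sinSumAux (-1) N) (Set.Ioc 0 π) := by
  refine monotoneOn_of_deriv_nonneg (convex_Ioc _ _) ?_ ?_ ?_
  · exact fun x hx => (hasDerivAt_sinSumAux (-1) N
      (sin_half_pos hx.1 hx.2).ne').continuousAt.continuousWithinAt
  · rw [interior_Ioc]
    exact fun x hx => (hasDerivAt_sinSumAux (-1) N
      (sin_half_pos hx.1 hx.2.le).ne').differentiableAt.differentiableWithinAt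
  · rw [interior_Ioc]
    intro x hx
    rw [(hasDerivAt_sinSumAux (-1) N (sin_half_pos hx.1 hx.2.le).ne').deriv]
    have := cos_le_one ((N + 1 / 2) * x)
    have hc : 0 ≤ cos (x / 2) := cos_nonneg_of_mem_Icc ⟨by linarith [hx.1, pi_pos], by linarith [hx.2]⟩
    have : 0 ≤ -(-1 + cos ((N + 1 / 2) * x)) := by linarith
    positivity

-- Up to `x₁ = π/(N + 1/2)` the Riemann sum bound applies. Beyond it, the decreasing auxiliary
-- function is compared with its value at `x₁`, where the correction term vanishes because the
-- cosine is `-1`.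
open Real in
lemma sinSum_le_Si_pi {N : ℕ} {x : ℝ} (h0 : 0 ≤ x) (h1 : x ≤ π) : sinSum N x ≤ Si π := by
  have hM : (0 : ℝ) < N + 1 / 2 := by positivity
  rcases le_total x (π / (N + 1 / 2)) with h | h
  · rw [le_div_iff₀ hM] at h
    exact sinSum_le_of_mul_le_pi h0 (by nlinarith)
  set x₁ := π / ((N : ℝ) + 1 / 2) with hx₁
  have hx₁0 : 0 < x₁ := by positivity
  have hMx : ((N : ℝ) + 1 / 2) * x₁ = π := by rw [hx₁]; field_simp
  have hx0 : 0 < x := hx₁0.trans_le h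
  have hle := sinSumAux_antitoneOn N (a := x₁) ⟨hx₁0, h.trans h1⟩ ⟨hx0, h1⟩ h
  have hs := sin_half_pos hx0 h1
  have hc : 0 ≤ 1 + cos ((N + 1 / 2) * x) := by linarith [neg_one_le_cos ((N + 1 / 2) * x)]
  simp only [sinSumAux, hMx, cos_pi, add_neg_cancel, zero_mul, add_zero] at hle
  have : 0 ≤ (1 + cos ((N + 1 / 2) * x)) * (((N : ℝ) + 1 / 2) * (2 * sin (x / 2)))⁻¹ := by
    positivity
  have := sinSum_le_of_mul_le_pi (N := N) hx₁0.le (by nlinarith)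
  linarith

-- The increasing auxiliary function has nonpositive correction term, so it lies below `sinSum N x +
-- x/2`. Near the origin it is bounded below by a quantity tending to zero, hence `sinSum N x + x/2`
-- is nonnegative.
open Real in
lemma neg_half_le_sinSum {N : ℕ} {x : ℝ} (h0 : 0 < x) (h1 : x ≤ π) : -(x / 2) ≤ sinSum N x := by
  have hM : (0 : ℝ) < N + 1 / 2 := by positivity
  -- With `m = N + 1/2`, the constant comes from `1 - cos(my) ≤ m^2 y^2/2` divided by `2m sin(y/2) ≥
  -- 2my/π`.
  have key : ∀ᶠ y in 𝓝[>] (0 : ℝ), -((N + 1 / 2) * π / 4 * y) ≤ sinSum N x + x / 2 := by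
    filter_upwards [Ioo_mem_nhdsGT h0,
      Ioo_mem_nhdsGT (show 0 < π / (N + 1 / 2) by positivity)] with y hy hy'
    have hmono := sinSumAux_monotoneOn N ⟨hy.1, hy.2.le.trans h1⟩ ⟨h0, h1⟩ hy.2.le
    have hs := sin_half_pos h0 h1
    have hc : cos ((N + 1 / 2) * x) ≤ 1 := cos_le_one _
    have h2 : (-1 + cos ((N + 1 / 2) * x)) * (((N : ℝ) + 1 / 2) * (2 * sin (x / 2)))⁻¹ ≤ 0 :=
      mul_nonpos_of_nonpos_of_nonneg (by linarith) (by positivity)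
    have hSy : 0 ≤ sinSum N y := by
      have := hy'.2
      rw [lt_div_iff₀ hM] at this
      exact sinSum_nonneg_of_mul_le_pi hy.1.le (by nlinarith [hy.1])
    have hsy : y / π ≤ sin (y / 2) := by
      have := mul_le_sin (x := y / 2) (by linarith [hy.1]) (by linarith [hy.2])
      refine le_trans (le_of_eq ?_) this
      field_simp
    have hcy := one_sub_sq_div_two_le_cos (x := ((N : ℝ) + 1 / 2) * y)
    have h3 : -(((N : ℝ) + 1 / 2) * π / 4 * y) ≤
        (-1 + cos ((N + 1 / 2) * y)) * (((N : ℝ) + 1 / 2) * (2 * sin (y / 2)))⁻¹ := by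
      have hy0 := hy.1
      have hsy0 := sin_half_pos hy.1 (hy.2.le.trans h1)
      rw [← div_eq_mul_inv, le_div_iff₀ (by positivity)]
      have : ((N : ℝ) + 1 / 2) ^ 2 * y ^ 2 / 2 ≤
          ((N : ℝ) + 1 / 2) * π / 4 * y * ((N + 1 / 2) * (2 * sin (y / 2))) := by
        calc ((N : ℝ) + 1 / 2) ^ 2 * y ^ 2 / 2
            = ((N : ℝ) + 1 / 2) * π / 4 * y * ((N + 1 / 2) * (2 * (y / π))) := by
              field_simp; ring
          _ ≤ _ := by gcongr
      nlinarith
    simp only [sinSumAux] at hmono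
    linarith [hy.1]
  have hlim : Tendsto (fun y : ℝ => -((N + 1 / 2) * π / 4 * y)) (𝓝[>] 0) (𝓝 0) := by
    have : Continuous fun y : ℝ => -((N + 1 / 2) * π / 4 * y) := by fun_prop
    simpa using (this.tendsto 0).mono_left nhdsWithin_le_nhds
  linarith [le_of_tendsto hlim key]

lemma sinSum_neg (N : ℕ) (x : ℝ) : sinSum N (-x) = -sinSum N x := by
  simp [sinSum, neg_div, ← Finset.sum_neg_distrib]

open Real in
lemma sinSum_periodic (N : ℕ) : Function.Periodic (sinSum N) (2 * π) := by
  intro x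
  refine Finset.sum_congr rfl fun j _ => ?_
  congr 1
  rw [mul_add]
  exact_mod_cast Real.sin_add_nat_mul_two_pi ((j + 1) * x) (j + 1)

open Real in
/-- The partial sums of the sawtooth series are bounded by the Gibbs constant. -/
theorem abs_sinSum_le (N : ℕ) (x : ℝ) : |sinSum N x| ≤ Si π := by
  have main : ∀ y, 0 ≤ y → y ≤ π → |sinSum N y| ≤ Si π := by
    intro y h0 h1
    refine abs_le.2 ⟨?_, sinSum_le_Si_pi h0 h1⟩
    rcases h0.eq_or_lt with h | h
    · rw [← h]
      simpa [sinSum] using (by linarith [pi_div_two_le_Si_pi, pi_pos] : 0 ≤ Si π)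
    · linarith [neg_half_le_sinSum (N := N) h h1, pi_div_two_le_Si_pi]
  obtain ⟨y, hy, hxy⟩ := (sinSum_periodic N).exists_mem_Ico (by positivity) x (-π)
  rw [hxy]
  rcases le_total 0 y with h | h
  · exact main y h (by linarith [hy.2])
  · rw [← abs_neg, ← sinSum_neg]
    exact main (-y) (by linarith) (by linarith [hy.1])

/-! ### Pointwise convergence of the cardinal series of an exponential. -/

/-- The truncated cardinal series of `exp (i a y)`. -/
noncomputable def sincSum (a : ℝ) (n : ℕ) (y : ℝ) : ℂ :=
  ∑ k ∈ Finset.Icc (-(n : ℤ)) n,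
    (Real.sinc (Real.pi * (a - k)) : ℂ) * Complex.exp (k * y * Complex.I)

lemma sum_Icc_neg_succ {M : Type*} [AddCommMonoid M] (f : ℤ → M) (n : ℕ) :
    ∑ k ∈ Finset.Icc (-((n + 1 : ℕ) : ℤ)) ((n + 1 : ℕ) : ℤ), f k =
      ∑ k ∈ Finset.Icc (-(n : ℤ)) n, f k + (f (n + 1) + f (-(n + 1))) := by
  have e : Finset.Icc (-((n + 1 : ℕ) : ℤ)) ((n + 1 : ℕ) : ℤ) =
      insert ((n : ℤ) + 1) (insert (-((n : ℤ) + 1)) (Finset.Icc (-(n : ℤ)) n)) := by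
    ext k
    simp only [Finset.mem_Icc, Finset.mem_insert]
    push_cast
    omega
  rw [e, Finset.sum_insert, Finset.sum_insert]
  · rw [add_comm (f (-((n : ℤ) + 1))), ← add_assoc, add_comm (f (n + 1)), add_assoc]
  · simp
  · simp only [Finset.mem_insert, Finset.mem_Icc, not_or]
    omega

lemma sum_Icc_telescope (f : ℤ → ℂ) (n : ℕ) :
    ∑ k ∈ Finset.Icc (-(n : ℤ)) n, (f (k - 1) - f k) = f (-n - 1) - f n := by
  induction n with
  | zero => simp
  | succ n ih =>
    rw [sum_Icc_neg_succ, ih]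
    push_cast
    rw [show (n : ℤ) + 1 - 1 = n by ring, show -((n : ℤ) + 1) = -n - 1 by ring]
    ring

lemma sinc_pi_mul_sub_int (a : ℝ) (k : ℤ) (h : a ≠ k) :
    Real.sinc (Real.pi * (a - k)) =
      (-1) ^ k * Real.sin (Real.pi * a) / (Real.pi * (a - k)) := by
  have h1 : a - k ≠ 0 := sub_ne_zero.2 h
  rw [Real.sinc_of_ne_zero (mul_ne_zero Real.pi_ne_zero h1), mul_sub,
    mul_comm Real.pi (k : ℝ), Real.sin_sub_int_mul_pi]

lemma integral_exp_int_mul (a : ℝ) (k : ℤ) :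
    ∫ u in (-Real.pi)..Real.pi, Complex.exp (a * u * Complex.I) * Complex.exp (-(k * u * Complex.I))
      = 2 * Real.pi * Real.sinc (Real.pi * (a - k)) := by
  have e : ∀ u : ℝ, Complex.exp (a * u * Complex.I) * Complex.exp (-(k * u * Complex.I)) =
      Complex.exp (((u * (a - k) : ℝ) : ℂ) * Complex.I) := fun u => by
    rw [← Complex.exp_add]; congr 1; push_cast; ring
  simp_rw [e]
  rcases eq_or_ne (a - k) 0 with h | h
  · simp [h]
    ring
  rw [intervalIntegral.integral_comp_mul_right
    (f := fun t : ℝ => Complex.exp ((t : ℂ) * Complex.I)) h, neg_mul,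
    integral_exp_mul_I_eq_sinc, Complex.real_smul]
  have h' : ((a : ℂ) - k) ≠ 0 := by exact_mod_cast h
  push_cast
  field_simp

lemma tendsto_fourier_coeff_atTop (g : ℝ → ℂ) {s : ℕ → ℤ}
    (hs : Tendsto (fun n => (s n : ℝ)) atTop (cocompact ℝ)) :
    Tendsto (fun n => ∫ u in (-Real.pi)..Real.pi, g u * Complex.exp (-(s n * u * Complex.I)))
      atTop (𝓝 0) := by
  have h := Real.tendsto_integral_exp_smul_cocompact
    (Set.indicator (Set.Ioc (-Real.pi) Real.pi) g)
  have h2 : Tendsto (fun n => (s n : ℝ) * (2 * Real.pi)⁻¹) atTop (cocompact ℝ) :=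
    (Homeomorph.mulRight₀ ((2 * Real.pi)⁻¹ : ℝ)
      (by positivity)).isClosedEmbedding.tendsto_cocompact.comp hs
  refine (h.comp h2).congr fun n => ?_
  simp only [Function.comp_def]
  rw [intervalIntegral.integral_of_le (by linarith [Real.pi_pos]),
    ← integral_indicator measurableSet_Ioc]
  refine integral_congr_ae (Eventually.of_forall fun u => ?_)
  by_cases hu : u ∈ Set.Ioc (-Real.pi) Real.pi
  · simp only [Set.indicator_of_mem hu, Circle.smul_def, Real.fourierChar_apply, smul_eq_mul]
    rw [mul_comm]
    congr 2
    push_cast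
    field_simp
  · simp [Set.indicator_of_notMem hu]

lemma exp_sub_exp_ne_zero {y u : ℝ} (hy : |y| < Real.pi) (hu : u ∈ Set.Icc (-Real.pi) Real.pi)
    (h : u ≠ y) : Complex.exp (u * Complex.I) - Complex.exp (y * Complex.I) ≠ 0 := by
  intro h0
  obtain ⟨m, hm⟩ := Complex.exp_eq_exp_iff_exists_int.1 (sub_eq_zero.1 h0)
  have hm' : u = y + m * (2 * Real.pi) := by
    have h1 : ((u : ℂ)) * Complex.I = ((y : ℂ) + m * (2 * Real.pi)) * Complex.I := by
      rw [hm]; ring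
    exact_mod_cast mul_right_cancel₀ Complex.I_ne_zero h1
  rw [abs_lt] at hy
  have hp := Real.pi_pos
  have h1 : (m : ℝ) < 1 := by nlinarith [hu.1, hu.2]
  have h2 : (-1 : ℝ) < m := by nlinarith [hu.1, hu.2]
  have h3 : m = 0 := by
    have : m < 1 := by exact_mod_cast h1
    have : -1 < m := by exact_mod_cast h2
    omega
  exact h (by simpa [h3] using hm')

lemma hasDerivAt_exp_mul_I (a y : ℝ) :
    HasDerivAt (fun u : ℝ => Complex.exp (a * u * Complex.I))
      (Complex.exp (a * y * Complex.I) * (a * Complex.I)) y := by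
  have h : HasDerivAt (fun u : ℂ => Complex.exp (a * u * Complex.I))
      (Complex.exp (a * (y : ℂ) * Complex.I) * (a * Complex.I)) (y : ℂ) := by
    have := (((hasDerivAt_id (y : ℂ)).const_mul (a : ℂ)).mul_const Complex.I).cexp
    simpa using this
  exact h.comp_ofReal

/-- The cardinal series of `exp (i a y)` converges pointwise inside the band. -/
theorem tendsto_sincSum (a : ℝ) {y : ℝ} (hy : |y| < Real.pi) :
    Tendsto (fun n => sincSum a n y) atTop (𝓝 (Complex.exp (a * y * Complex.I))) := by
  set f : ℝ → ℂ := fun u => Complex.exp (a * u * Complex.I) with hf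
  set e : ℝ → ℂ := fun u => Complex.exp (u * Complex.I) with he
  have hfd := hasDerivAt_exp_mul_I a y
  have hed : HasDerivAt e (Complex.exp (y * Complex.I) * Complex.I) y := by
    simpa using hasDerivAt_exp_mul_I 1 y
  -- `g` is the quotient `(f u - f y)/(e u - e y)`, continuous across `u = y`. Since `|y| < π`, the
  -- denominator has no other zero on the closed period.
  set g : ℝ → ℂ := fun u => dslope f y u / dslope e y u with hg
  have hyI : Set.Icc (-Real.pi) Real.pi ∈ 𝓝 y :=
    Icc_mem_nhds (abs_lt.1 hy).1 (abs_lt.1 hy).2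
  have hde : ∀ u ∈ Set.Icc (-Real.pi) Real.pi, dslope e y u ≠ 0 := by
    intro u hu
    rcases eq_or_ne u y with h | h
    · rw [h, dslope_same, hed.deriv]
      exact mul_ne_zero (Complex.exp_ne_zero _) Complex.I_ne_zero
    · rw [dslope_of_ne _ h, slope_def_module]
      exact smul_ne_zero (inv_ne_zero (sub_ne_zero.2 h)) (exp_sub_exp_ne_zero hy hu h)
  have hgc : ContinuousOn g (Set.Icc (-Real.pi) Real.pi) := by
    refine ContinuousOn.div ?_ ?_ hde
    · exact (continuousOn_dslope hyI).2 ⟨by fun_prop, hfd.differentiableAt⟩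
    · exact (continuousOn_dslope hyI).2 ⟨by fun_prop, hed.differentiableAt⟩
  have hfg : ∀ u ∈ Set.Icc (-Real.pi) Real.pi, f u - f y = (e u - e y) * g u := by
    intro u hu
    have h1 := sub_smul_dslope f y u
    have h2 := sub_smul_dslope e y u
    rw [← h1, ← h2, hg]
    simp only [smul_mul_assoc, mul_div_cancel₀ _ (hde u hu)]
  set G : ℤ → ℂ := fun k =>
    ∫ u in (-Real.pi)..Real.pi, g u * Complex.exp (-(k * u * Complex.I)) with hG
  have hpp : -Real.pi ≤ Real.pi := by linarith [Real.pi_pos]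
  have hgi : ∀ k : ℤ, IntervalIntegrable (fun u => g u * Complex.exp (-(k * u * Complex.I)))
      volume (-Real.pi) Real.pi := fun k => by
    refine ContinuousOn.intervalIntegrable ?_
    rw [Set.uIcc_of_le hpp]
    exact hgc.mul (by fun_prop)
  -- Taking Fourier coefficients in `f - f y = (e - e y) g` gives a shift difference of those of
  -- `g`. After multiplication by `exp(iky)` the sum over `k` telescopes, and the two boundary terms
  -- vanish by the Riemann–Lebesgue lemma.
  have hci : ∀ k : ℤ, 2 * Real.pi * (Real.sinc (Real.pi * (a - k)) : ℂ)
      - f y * (2 * Real.pi * Real.sinc (Real.pi * (0 - k))) = G (k - 1) - e y * G k := by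
    intro k
    rw [← integral_exp_int_mul, ← integral_exp_int_mul, hG]
    simp only
    rw [← intervalIntegral.integral_const_mul, ← intervalIntegral.integral_const_mul,
      ← intervalIntegral.integral_sub, ← intervalIntegral.integral_sub (hgi _)
      ((hgi _).const_mul _)]
    · refine intervalIntegral.integral_congr fun u hu => ?_
      rw [Set.uIcc_of_le hpp] at hu
      have h1 := hfg u hu
      have h2 : Complex.exp (-(((k - 1 : ℤ) : ℂ) * u * Complex.I)) =
          e u * Complex.exp (-(k * u * Complex.I)) := by
        rw [he, ← Complex.exp_add]; congr 1; push_cast; ring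
      simp only [h2]
      simp only [Complex.ofReal_zero, zero_mul, Complex.exp_zero, one_mul]
      linear_combination Complex.exp (-(k * u * Complex.I)) * h1
    · exact Continuous.intervalIntegrable (by fun_prop) _ _
    · exact Continuous.intervalIntegrable (by fun_prop) _ _
  have hzero : ∀ n : ℕ, ∑ k ∈ Finset.Icc (-(n : ℤ)) n,
      (Real.sinc (Real.pi * (0 - k)) : ℂ) * Complex.exp (k * y * Complex.I) = 1 := by
    intro n
    rw [Finset.sum_eq_single 0]
    · simp
    · intro k _ hk
      rw [sinc_pi_mul_sub_int 0 k (by exact_mod_cast hk.symm)]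
      simp
    · simp
  have hsum : ∀ n : ℕ, 2 * Real.pi * (sincSum a n y - f y) =
      G (-n - 1) * Complex.exp (-(n * y * Complex.I)) -
        G n * Complex.exp ((n + 1) * y * Complex.I) := by
    intro n
    have ht := sum_Icc_telescope (fun k => G k * Complex.exp ((k + 1) * y * Complex.I)) n
    have e1 : ((-n - 1 : ℤ) : ℂ) + 1 = -n := by push_cast; ring
    simp only [e1, Int.cast_natCast] at ht
    rw [neg_mul, neg_mul] at ht
    rw [← ht]
    calc 2 * Real.pi * (sincSum a n y - f y)
        = 2 * Real.pi * (sincSum a n y - f y * ∑ k ∈ Finset.Icc (-(n : ℤ)) n,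
      (Real.sinc (Real.pi * (0 - k)) : ℂ) * Complex.exp (k * y * Complex.I)) := by
          rw [hzero, mul_one]
      _ = _ := by
          rw [sincSum, Finset.mul_sum, ← Finset.sum_sub_distrib, Finset.mul_sum]
          refine Finset.sum_congr rfl fun k _ => ?_
          have e2 : Complex.exp ((k + 1) * y * Complex.I) =
              e y * Complex.exp (k * y * Complex.I) := by
            rw [he, ← Complex.exp_add]; congr 1; ring
          have e3 : (((k - 1 : ℤ) : ℂ) + 1) = k := by push_cast; ring
          rw [e2, e3]
          linear_combination Complex.exp (k * y * Complex.I) * hci k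
  have hcoc : Tendsto (fun n : ℕ => (n : ℝ)) atTop (cocompact ℝ) :=
    tendsto_natCast_atTop_atTop.mono_right atTop_le_cocompact
  have hG1 : Tendsto (fun n : ℕ => G (n : ℤ)) atTop (𝓝 0) :=
    tendsto_fourier_coeff_atTop g (s := fun n => (n : ℤ)) (by simpa using hcoc)
  have hG2 : Tendsto (fun n : ℕ => G (-n - 1)) atTop (𝓝 0) := by
    refine tendsto_fourier_coeff_atTop g (s := fun n => -(n : ℤ) - 1) ?_
    refine Tendsto.mono_right ?_ atBot_le_cocompact
    push_cast
    exact tendsto_atBot_add_const_right _ _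
      (tendsto_neg_atTop_atBot.comp tendsto_natCast_atTop_atTop)
  have hlim : Tendsto (fun n : ℕ => 2 * Real.pi * (sincSum a n y - f y)) atTop (𝓝 0) := by
    rw [tendsto_zero_iff_norm_tendsto_zero]
    refine squeeze_zero (fun _ => norm_nonneg _) (fun n => ?_)
      (by simpa using hG2.norm.add hG1.norm)
    rw [hsum]
    refine (norm_sub_le _ _).trans (le_of_eq ?_)
    rw [norm_mul, norm_mul]
    have n1 : ‖Complex.exp (-(n * y * Complex.I))‖ = 1 := by
      have := Complex.norm_exp_ofReal_mul_I (-(n * y))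
      push_cast at this; rwa [neg_mul] at this
    have n2 : ‖Complex.exp ((n + 1) * y * Complex.I)‖ = 1 := by
      have := Complex.norm_exp_ofReal_mul_I ((n + 1) * y)
      push_cast at this; exact this
    rw [n1, n2, mul_one, mul_one]
  have h2p : (2 * Real.pi : ℂ) ≠ 0 := by exact_mod_cast (by positivity : (2 * Real.pi : ℝ) ≠ 0)
  have h := (hlim.const_mul (2 * Real.pi : ℂ)⁻¹).add_const (f y)
  simp only [mul_zero, zero_add] at h
  refine h.congr fun n => ?_
  field_simp
  ring

/-! ### Abel summation and the truncation error inside the band. -/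

lemma norm_sum_mul_pow_le {c : ℕ → ℝ} (hc : Antitone c) (hc0 : ∀ j, 0 ≤ c j) {w : ℂ}
    (hw : ‖w‖ = 1) (m : ℕ) : ‖(1 - w) * ∑ j ∈ Finset.range m, c j * w ^ j‖ ≤ 2 * c 0 := by
  -- With the boundary term added, the expression is `c 0` minus a combination of powers of `w`
  -- whose coefficients are the decrements of `c`, and these sum to `c 0 - c m`.
  have key : ∀ m, ‖(1 - w) * ∑ j ∈ Finset.range (m + 1), c j * w ^ j + c m * w ^ (m + 1)‖
      ≤ 2 * c 0 - c m := by
    intro m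
    induction m with
    | zero =>
      have : (1 - w) * ∑ j ∈ Finset.range (0 + 1), (c j : ℂ) * w ^ j + c 0 * w ^ (0 + 1) = c 0 := by
        simp; ring
      rw [this, Complex.norm_real, Real.norm_eq_abs, abs_of_nonneg (hc0 0)]
      linarith
    | succ m ih =>
      have : (1 - w) * ∑ j ∈ Finset.range (m + 1 + 1), (c j : ℂ) * w ^ j
          + c (m + 1) * w ^ (m + 1 + 1) =
          ((1 - w) * ∑ j ∈ Finset.range (m + 1), (c j : ℂ) * w ^ j + c m * w ^ (m + 1)) -
          ((c m - c (m + 1) : ℝ) : ℂ) * w ^ (m + 1) := by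
        rw [Finset.sum_range_succ _ (m + 1)]; push_cast; ring
      rw [this]
      refine (norm_sub_le _ _).trans ?_
      rw [norm_mul, norm_pow, hw, one_pow, mul_one, Complex.norm_real, Real.norm_eq_abs,
        abs_of_nonneg (sub_nonneg.2 (hc (Nat.le_succ m)))]
      linarith
  cases m with
  | zero => simpa using hc0 0
  | succ m =>
    have h := key m
    have h2 := norm_sub_norm_le ((1 - w) * ∑ j ∈ Finset.range (m + 1), (c j : ℂ) * w ^ j)
      (-(c m * w ^ (m + 1)))
    have h3 : ‖(c m : ℂ) * w ^ (m + 1)‖ = c m := by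
      rw [norm_mul, norm_pow, hw, one_pow, mul_one, Complex.norm_real, Real.norm_eq_abs,
        abs_of_nonneg (hc0 m)]
    rw [sub_neg_eq_add, norm_neg, h3] at h2
    linarith

lemma norm_one_add_exp {y : ℝ} (hy : |y| ≤ Real.pi) :
    ‖1 + Complex.exp (y * Complex.I)‖ = 2 * Real.cos (y / 2) := by
  have hc : 0 ≤ Real.cos (y / 2) := by
    rw [abs_le] at hy
    exact Real.cos_nonneg_of_mem_Icc ⟨by linarith [hy.1], by linarith [hy.2]⟩
  have e : (1 : ℂ) + Complex.exp (y * Complex.I) =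
      Complex.exp ((y / 2 : ℝ) * Complex.I) * ((2 * Real.cos (y / 2) : ℝ) : ℂ) := by
    push_cast
    rw [Complex.two_cos, mul_add, ← Complex.exp_add, ← Complex.exp_add,
      show (y : ℂ) / 2 * Complex.I + y / 2 * Complex.I = y * Complex.I by ring,
      show (y : ℂ) / 2 * Complex.I + -(y / 2) * Complex.I = 0 by ring, Complex.exp_zero, add_comm]
  rw [e, norm_mul, Complex.norm_exp_ofReal_mul_I, one_mul, Complex.norm_real, Real.norm_eq_abs,
    abs_of_nonneg (by positivity)]

lemma norm_sum_alternating_le {c : ℕ → ℝ} (hc : Antitone c) (hc0 : ∀ j, 0 ≤ c j) {y : ℝ}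
    (hy : |y| < Real.pi) (m : ℕ) :
    ‖∑ j ∈ Finset.range m, c j * (-Complex.exp (y * Complex.I)) ^ j‖ ≤
      c 0 / Real.cos (y / 2) := by
  have hcos : 0 < Real.cos (y / 2) := by
    rw [abs_lt] at hy
    exact Real.cos_pos_of_mem_Ioo ⟨by linarith [hy.1], by linarith [hy.2]⟩
  have h := norm_sum_mul_pow_le hc hc0 (w := -Complex.exp (y * Complex.I))
    (by rw [norm_neg, Complex.norm_exp_ofReal_mul_I]) m
  rw [norm_mul, sub_neg_eq_add, norm_one_add_exp hy.le] at h
  rw [le_div_iff₀ hcos]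
  nlinarith

/-- Outside the centre `sinc(π(a - k))` is `(-1)^k sin(πa)/(π(a - k))`. The sign joins the
exponential, so each side of the tail is a power series in `-exp(±iy)` with decreasing positive
coefficients, ready for Abel summation. -/
lemma sincSum_add (a : ℝ) (n m : ℕ) (y : ℝ) (ha0 : 0 ≤ a) (han : a < n) :
    sincSum a (n + m) y - sincSum a n y = (Real.sin (Real.pi * a) / Real.pi : ℝ) *
      ((-Complex.exp ((-y : ℝ) * Complex.I)) ^ (n + 1) *
        (∑ j ∈ Finset.range m, (((n + 1 + j + a)⁻¹ : ℝ) : ℂ) *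
          (-Complex.exp ((-y : ℝ) * Complex.I)) ^ j) -
      (-Complex.exp (y * Complex.I)) ^ (n + 1) *
        (∑ j ∈ Finset.range m, (((n + 1 + j - a)⁻¹ : ℝ) : ℂ) *
          (-Complex.exp (y * Complex.I)) ^ j)) := by
  induction m with
  | zero => simp
  | succ m ih =>
    rw [Finset.sum_range_succ, Finset.sum_range_succ, ← add_assoc, sincSum, sum_Icc_neg_succ,
      ← sincSum, add_sub_right_comm, ih]
    have hp : (0 : ℝ) < n + 1 + m - a := by
      have : (0 : ℝ) ≤ m := by positivity
      linarith
    have hq : (0 : ℝ) < n + 1 + m + a := by positivity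
    have s1 := sinc_pi_mul_sub_int a (((n + m : ℕ) : ℤ) + 1) (by push_cast; linarith)
    have s2 := sinc_pi_mul_sub_int a (-(((n + m : ℕ) : ℤ) + 1)) (by push_cast; linarith)
    have p1 : ((-1 : ℝ)) ^ (((n + m : ℕ) : ℤ) + 1) = (-1) ^ (n + 1 + m) := by
      rw [← zpow_natCast]; congr 1; push_cast; ring
    have p2 : ((-1 : ℝ)) ^ (-(((n + m : ℕ) : ℤ) + 1)) = (-1) ^ (n + 1 + m) := by
      rw [zpow_neg, p1, ← inv_pow]; norm_num
    rw [p1] at s1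
    rw [p2] at s2
    have t1 : Real.sinc (Real.pi * (a - ((((n + m : ℕ) : ℤ) + 1 : ℤ) : ℝ))) =
        -(Real.sin (Real.pi * a) / Real.pi) * (-1) ^ (n + 1 + m) * (n + 1 + m - a)⁻¹ := by
      rw [s1]
      have : (a - ((((n + m : ℕ) : ℤ) + 1 : ℤ) : ℝ)) = -(n + 1 + m - a) := by push_cast; ring
      rw [this]
      field_simp
    have t2 : Real.sinc (Real.pi * (a - ((-(((n + m : ℕ) : ℤ) + 1) : ℤ) : ℝ))) =
        (Real.sin (Real.pi * a) / Real.pi) * (-1) ^ (n + 1 + m) * (n + 1 + m + a)⁻¹ := by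
      rw [s2]
      have : (a - ((-(((n + m : ℕ) : ℤ) + 1) : ℤ) : ℝ)) = n + 1 + m + a := by push_cast; ring
      rw [this]
      field_simp
    have x1 : Complex.exp (((((n + m : ℕ) : ℤ) + 1 : ℤ) : ℂ) * y * Complex.I) =
        Complex.exp (y * Complex.I) ^ (n + 1 + m) := by
      rw [← Complex.exp_nat_mul]; congr 1; push_cast; ring
    have x2 : Complex.exp (((-(((n + m : ℕ) : ℤ) + 1) : ℤ) : ℂ) * y * Complex.I) =
        Complex.exp ((-y : ℝ) * Complex.I) ^ (n + 1 + m) := by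
      rw [← Complex.exp_nat_mul]; congr 1; push_cast; ring
    rw [t1, t2, x1, x2, neg_pow (Complex.exp (y * Complex.I)) m,
      neg_pow (Complex.exp (y * Complex.I)) (n + 1),
      neg_pow (Complex.exp ((-y : ℝ) * Complex.I)) m,
      neg_pow (Complex.exp ((-y : ℝ) * Complex.I)) (n + 1)]
    generalize Complex.exp ((-y : ℝ) * Complex.I) = E₁
    generalize Complex.exp (y * Complex.I) = E₂
    push_cast
    ring

/-- The truncation error of the cardinal series inside the band. -/
theorem norm_exp_sub_sincSum_le {a y : ℝ} {n : ℕ} (ha0 : 0 ≤ a) (han : a < n)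
    (hy : |y| < Real.pi) :
    ‖Complex.exp (a * y * Complex.I) - sincSum a n y‖ ≤
      |Real.sin (Real.pi * a)| / Real.pi *
        (((n + 1 + a)⁻¹ + (n + 1 - a)⁻¹) / Real.cos (y / 2)) := by
  have hlim : Tendsto (fun m => ‖sincSum a (n + m) y - sincSum a n y‖) atTop
      (𝓝 ‖Complex.exp (a * y * Complex.I) - sincSum a n y‖) := by
    refine Tendsto.norm (Tendsto.sub_const ?_ _)
    simpa [add_comm] using (tendsto_add_atTop_iff_nat n).2 (tendsto_sincSum a hy)
  refine le_of_tendsto' hlim fun m => ?_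
  rw [sincSum_add a n m y ha0 han, norm_mul, Complex.norm_real, Real.norm_eq_abs, abs_div,
    abs_of_pos Real.pi_pos]
  refine mul_le_mul_of_nonneg_left ?_ (by positivity)
  refine (norm_sub_le _ _).trans ?_
  rw [norm_mul, norm_mul, norm_pow, norm_pow, norm_neg, norm_neg, Complex.norm_exp_ofReal_mul_I,
    Complex.norm_exp_ofReal_mul_I, one_pow, one_mul, one_mul, add_div]
  refine add_le_add ?_ ?_
  · have h := norm_sum_alternating_le (c := fun j => ((n : ℝ) + 1 + j + a)⁻¹) (y := -y)
      (fun i j hij => by dsimp only; gcongr) (fun j => by positivity) (by rwa [abs_neg]) m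
    simpa [neg_div, Real.cos_neg] using h
  · have hpos : ∀ j : ℕ, (0 : ℝ) < n + 1 + j - a := fun j => by
      have : (0 : ℝ) ≤ j := by positivity
      linarith
    have h := norm_sum_alternating_le (c := fun j => ((n : ℝ) + 1 + j - a)⁻¹) (y := y)
      (fun i j hij => by
        dsimp only
        have := hpos i
        gcongr) (fun j => (inv_pos.2 (hpos j)).le) hy m
    simpa using h

/-! ### Boundedness of the truncated cardinal series at every frequency. -/

lemma sum_inv_sq_sub_quarter_le (N : ℕ) :
    ∑ i ∈ Finset.range N, 1 / (((i : ℝ) + 1) ^ 2 - 1 / 4) ≤ 2 := by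
  have h : ∀ N : ℕ, ∑ i ∈ Finset.range N, 1 / (((i : ℝ) + 1) ^ 2 - 1 / 4) =
      2 - 1 / ((N : ℝ) + 1 / 2) := by
    intro N
    induction N with
    | zero => norm_num
    | succ N ih =>
      rw [Finset.sum_range_succ, ih]
      have h1 : (N : ℝ) + 1 / 2 ≠ 0 := by positivity
      have h2 : (N : ℝ) + 1 + 1 / 2 ≠ 0 := by positivity
      have h3 : ((N : ℝ) + 1) ^ 2 - 1 / 4 = (N + 1 / 2) * (N + 1 + 1 / 2) := by ring
      rw [h3]
      push_cast
      field_simp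
      ring
  rw [h]
  have : (0 : ℝ) ≤ 1 / ((N : ℝ) + 1 / 2) := by positivity
  linarith

/-- The terms of index `i + 1` and `-(i + 1)` are combined, and shifting `y` by `π` absorbs the sign
`(-1)^(i + 1)`. The cosine part is then absolutely summable, and only the sine part needs
cancellation. -/
lemma sincSum_eq_pairs {d : ℝ} (hd : |d| ≤ 1 / 2) (N : ℕ) (y : ℝ) :
    sincSum d N y = (Real.sinc (Real.pi * d) : ℂ) - (Real.sin (Real.pi * d) / Real.pi : ℝ) *
      (((∑ i ∈ Finset.range N, 2 * d * Real.cos ((i + 1) * (y + Real.pi)) /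
          (((i : ℝ) + 1) ^ 2 - d ^ 2) : ℝ) : ℂ) +
        ((∑ i ∈ Finset.range N, 2 * ((i : ℝ) + 1) * Real.sin ((i + 1) * (y + Real.pi)) /
          (((i : ℝ) + 1) ^ 2 - d ^ 2) : ℝ) : ℂ) * Complex.I) := by
  induction N with
  | zero => simp [sincSum]
  | succ N ih =>
    rw [sincSum, sum_Icc_neg_succ, ← sincSum, ih, Finset.sum_range_succ, Finset.sum_range_succ]
    rw [abs_le] at hd
    have hN : (0 : ℝ) ≤ N := by positivity
    have h1 : (N : ℝ) + 1 - d ≠ 0 := by linarith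
    have h2 : (N : ℝ) + 1 + d ≠ 0 := by linarith
    have s1 := sinc_pi_mul_sub_int d ((N : ℤ) + 1) (by push_cast; intro h; apply h1; linarith)
    have s2 := sinc_pi_mul_sub_int d (-((N : ℤ) + 1)) (by push_cast; intro h; apply h2; linarith)
    have p1 : ((-1 : ℝ)) ^ ((N : ℤ) + 1) = (-1) ^ (N + 1) := by
      rw [← zpow_natCast]; congr 1
    have p2 : ((-1 : ℝ)) ^ (-((N : ℤ) + 1)) = (-1) ^ (N + 1) := by
      rw [zpow_neg, p1, ← inv_pow]; norm_num
    rw [p1] at s1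
    rw [p2] at s2
    have e1 : ((N : ℝ) + 1) * (y + Real.pi) = (N + 1) * y + (N + 1 : ℕ) * Real.pi := by
      push_cast; ring
    have x1 : Complex.exp ((((N : ℤ) + 1 : ℤ) : ℂ) * y * Complex.I) =
        (Real.cos ((N + 1) * y) : ℂ) + (Real.sin ((N + 1) * y) : ℂ) * Complex.I := by
      rw [Complex.ofReal_cos, Complex.ofReal_sin, ← Complex.exp_mul_I]
      congr 1; push_cast; ring
    have x2 : Complex.exp (((-((N : ℤ) + 1) : ℤ) : ℂ) * y * Complex.I) =
        (Real.cos ((N + 1) * y) : ℂ) - (Real.sin ((N + 1) * y) : ℂ) * Complex.I := by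
      rw [Complex.ofReal_cos, Complex.ofReal_sin, sub_eq_add_neg, ← neg_mul, ← Complex.cos_neg,
        ← Complex.sin_neg, ← Complex.exp_mul_I]
      congr 1; push_cast; ring
    have c1 : (N : ℂ) + 1 - d ≠ 0 := by exact_mod_cast h1
    have c2 : (N : ℂ) + 1 + d ≠ 0 := by exact_mod_cast h2
    have c3 : (d : ℂ) - (N + 1) ≠ 0 := fun h => c1 (by linear_combination -h)
    have c4 : (d : ℂ) - -(N + 1) ≠ 0 := fun h => c2 (by linear_combination h)
    have c5 : ((N : ℂ) + 1) ^ 2 - d ^ 2 ≠ 0 := by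
      rw [sq_sub_sq]; exact mul_ne_zero c2 c1
    have hpi : (Real.pi : ℂ) ≠ 0 := by exact_mod_cast Real.pi_ne_zero
    rw [s1, s2, x1, x2, e1, Real.cos_add_nat_mul_pi, Real.sin_add_nat_mul_pi]
    generalize Real.cos ((N + 1) * y) = C
    generalize Real.sin ((N + 1) * y) = S
    generalize (∑ i ∈ Finset.range N, 2 * d * Real.cos ((i + 1) * (y + Real.pi)) /
      (((i : ℝ) + 1) ^ 2 - d ^ 2)) = R
    generalize (∑ i ∈ Finset.range N, 2 * ((i : ℝ) + 1) * Real.sin ((i + 1) * (y + Real.pi)) /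
      (((i : ℝ) + 1) ^ 2 - d ^ 2)) = I
    push_cast
    rw [show (d : ℂ) - (N + 1) = -(N + 1 - d) by ring,
      show (d : ℂ) - -(N + 1) = N + 1 + d by ring, sq_sub_sq]
    generalize (-1 : ℂ) ^ (N + 1) = q
    generalize Complex.sin (Real.pi * d) = s
    field_simp
    ring

/-- Uniform boundedness of the symmetric cardinal sums near the centre. -/
lemma norm_sincSum_le_of_abs_le_half {d : ℝ} (hd : |d| ≤ 1 / 2) (N : ℕ) (y : ℝ) :
    ‖sincSum d N y‖ ≤ 1 + |Real.sin (Real.pi * d)| / Real.pi * (2 + 2 * Si Real.pi) := by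
  have hS := pi_div_two_le_Si_pi
  have hpi := Real.pi_gt_three
  have hd2 : d ^ 2 ≤ 1 / 4 := by
    rw [← sq_abs]; nlinarith [abs_nonneg d]
  have hden : ∀ i : ℕ, 0 < ((i : ℝ) + 1) ^ 2 - 1 / 4 := fun i => by
    have : (0 : ℝ) ≤ i := by positivity
    nlinarith
  have hden' : ∀ i : ℕ, ((i : ℝ) + 1) ^ 2 - 1 / 4 ≤ ((i : ℝ) + 1) ^ 2 - d ^ 2 := fun i => by
    linarith
  rw [sincSum_eq_pairs hd]
  set R := ∑ i ∈ Finset.range N, 2 * d * Real.cos ((i + 1) * (y + Real.pi)) /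
          (((i : ℝ) + 1) ^ 2 - d ^ 2) with hR
  set I := ∑ i ∈ Finset.range N, 2 * ((i : ℝ) + 1) * Real.sin ((i + 1) * (y + Real.pi)) /
          (((i : ℝ) + 1) ^ 2 - d ^ 2) with hI
  have hRle : |R| ≤ 2 := by
    refine (Finset.abs_sum_le_sum_abs _ _).trans
      (le_trans (Finset.sum_le_sum fun i _ => ?_) (sum_inv_sq_sub_quarter_le N))
    rw [abs_div, abs_of_pos ((hden i).trans_le (hden' i))]
    refine div_le_div₀ zero_le_one ?_ (hden i) (hden' i)
    rw [abs_mul, abs_mul, abs_two]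
    have := Real.abs_cos_le_one ((i + 1) * (y + Real.pi))
    nlinarith [abs_nonneg d, abs_nonneg (Real.cos ((i + 1) * (y + Real.pi)))]
  -- With `j = i + 1`, `2j/(j^2 - d^2) = 2/j + 2d^2/(j(j^2 - d^2))`: twice the sawtooth sum plus an
  -- absolutely summable remainder.
  have hIeq : I = 2 * sinSum N (y + Real.pi) + ∑ i ∈ Finset.range N,
      2 * d ^ 2 * Real.sin ((i + 1) * (y + Real.pi)) /
        (((i : ℝ) + 1) * (((i : ℝ) + 1) ^ 2 - d ^ 2)) := by
    rw [hI, sinSum, Finset.mul_sum, ← Finset.sum_add_distrib]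
    refine Finset.sum_congr rfl fun i _ => ?_
    have h1 := ((hden i).trans_le (hden' i)).ne'
    have h2 : (i : ℝ) + 1 ≠ 0 := by positivity
    field_simp
    ring
  have hIle : |I| ≤ 2 * Si Real.pi + 1 := by
    rw [hIeq]
    refine (abs_add_le _ _).trans (add_le_add ?_ ?_)
    · rw [abs_mul, abs_two]
      exact mul_le_mul_of_nonneg_left (abs_sinSum_le _ _) zero_le_two
    · refine (Finset.abs_sum_le_sum_abs _ _).trans (le_trans (Finset.sum_le_sum (g := fun i : ℕ =>
        1 / 2 * (1 / (((i : ℝ) + 1) ^ 2 - 1 / 4))) fun i _ => ?_) ?_)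
      · have h0 := (hden i).trans_le (hden' i)
        have hi : (0 : ℝ) ≤ i := by positivity
        rw [abs_div, abs_of_pos (a := ((i : ℝ) + 1) * (((i : ℝ) + 1) ^ 2 - d ^ 2)) (by positivity),
          ← mul_div_assoc, mul_one]
        refine div_le_div₀ (by norm_num) ?_ (hden i) ?_
        · rw [abs_mul, abs_of_nonneg (by positivity)]
          have := Real.abs_sin_le_one ((i + 1) * (y + Real.pi))
          nlinarith [sq_nonneg d, abs_nonneg (Real.sin ((i + 1) * (y + Real.pi)))]
        · nlinarith [hden' i]
      · rw [← Finset.mul_sum]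
        linarith [sum_inv_sq_sub_quarter_le N]
  -- The Euclidean norm is needed, since `|R| + |I|` would only give `3 + 2 Si π`. The squares fit
  -- because `4 Si π ≥ 1`.
  have hRI : ‖(R : ℂ) + (I : ℂ) * Complex.I‖ ≤ 2 + 2 * Si Real.pi := by
    refine abs_le_of_sq_le_sq' ?_ (by linarith) |>.2
    rw [Complex.sq_norm, Complex.normSq_add_mul_I]
    have h1 : R ^ 2 ≤ 2 ^ 2 := sq_le_sq' (abs_le.1 hRle).1 (abs_le.1 hRle).2
    have h2 : I ^ 2 ≤ (2 * Si Real.pi + 1) ^ 2 :=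
      sq_le_sq' (abs_le.1 hIle).1 (abs_le.1 hIle).2
    nlinarith
  refine (norm_sub_le _ _).trans (add_le_add ?_ ?_)
  · rw [Complex.norm_real, Real.norm_eq_abs]
    exact Real.abs_sinc_le_one _
  · rw [norm_mul, Complex.norm_real, Real.norm_eq_abs, abs_div, abs_of_pos Real.pi_pos]
    gcongr

lemma sum_Icc_shift_eq_sincSum (a : ℝ) (n m : ℕ) (hm : m ≤ n) (y : ℝ) :
    ∑ k ∈ Finset.Icc (2 * (m : ℤ) - n) n,
      (Real.sinc (Real.pi * (a - k)) : ℂ) * Complex.exp (k * y * Complex.I) =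
      Complex.exp (m * y * Complex.I) * sincSum (a - m) (n - m) y := by
  rw [sincSum, Finset.mul_sum]
  refine Finset.sum_nbij' (fun k => k - m) (fun k => k + m) ?_ ?_ ?_ ?_ ?_
  · intro k hk; rw [Finset.mem_Icc] at hk ⊢; omega
  · intro k hk; rw [Finset.mem_Icc] at hk ⊢; omega
  · intro k _; ring
  · intro k _; ring
  · intro k _
    have e : Complex.exp (k * y * Complex.I) = Complex.exp (m * y * Complex.I) *
        Complex.exp (((k - m : ℤ) : ℂ) * y * Complex.I) := by
      rw [← Complex.exp_add]; congr 1; push_cast; ring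
    rw [e, show a - (m : ℝ) - ((k - m : ℤ) : ℝ) = a - k by push_cast; ring]
    ring

/-- Uniform boundedness of the truncated cardinal series. -/
theorem norm_sincSum_le {a : ℝ} {n : ℕ} (ha0 : 0 ≤ a) (han : a < n) (y : ℝ) :
    ‖sincSum a n y‖ ≤ 1 + 2 * |Real.sin (Real.pi * a)| / Real.pi *
      (1 + Si Real.pi + (a + 1 / 2) / (n - a)) := by
  -- `m` is an integer nearest to `a`. The indices from `2m - n` to `n` form a window symmetric
  -- about `m`, and the `2m` leftover indices all lie at distance at least `n - a` from `a`.
  set m := ⌊a + 1 / 2⌋₊ with hm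
  have hm1 : (m : ℝ) ≤ a + 1 / 2 := Nat.floor_le (by positivity)
  have hm2 : a + 1 / 2 < m + 1 := Nat.lt_floor_add_one _
  have hmn : m ≤ n := by
    have : (m : ℝ) < n + 1 := by linarith
    exact Nat.lt_succ_iff.1 (by exact_mod_cast this)
  have hsplit : Finset.Icc (-(n : ℤ)) n =
      Finset.Icc (-(n : ℤ)) (2 * m - n - 1) ∪ Finset.Icc (2 * (m : ℤ) - n) n := by
    ext k
    simp only [Finset.mem_union, Finset.mem_Icc]
    omega
  have hdisj : Disjoint (Finset.Icc (-(n : ℤ)) (2 * m - n - 1))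
      (Finset.Icc (2 * (m : ℤ) - n) n) := by
    rw [Finset.disjoint_left]
    intro k h1 h2
    rw [Finset.mem_Icc] at h1 h2
    omega
  have hsin : |Real.sin (Real.pi * (a - m))| = |Real.sin (Real.pi * a)| := by
    rw [mul_sub, mul_comm Real.pi (m : ℝ), Real.sin_sub_nat_mul_pi, abs_mul, abs_pow, abs_neg,
      abs_one, one_pow, one_mul]
  have hrest : ‖∑ k ∈ Finset.Icc (-(n : ℤ)) (2 * m - n - 1),
      (Real.sinc (Real.pi * (a - k)) : ℂ) * Complex.exp (k * y * Complex.I)‖ ≤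
      (2 * m) * (|Real.sin (Real.pi * a)| / (Real.pi * (n - a))) := by
    refine (norm_sum_le_of_le _ (f := fun k : ℤ => (Real.sinc (Real.pi * (a - k)) : ℂ) *
      Complex.exp (k * y * Complex.I))
      (n := fun _ => |Real.sin (Real.pi * a)| / (Real.pi * (n - a))) fun k hk => ?_).trans ?_
    · rw [Finset.mem_Icc] at hk
      have hk2 : (k : ℝ) ≤ 2 * m - n - 1 := by exact_mod_cast hk.2
      have hak : (n : ℝ) - a ≤ a - k := by linarith
      have hna : (0 : ℝ) < n - a := by linarith
      have hexp := Complex.norm_exp_ofReal_mul_I (k * y)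
      push_cast at hexp
      rw [norm_mul, hexp, mul_one, Complex.norm_real, Real.norm_eq_abs,
        sinc_pi_mul_sub_int a k (by linarith), abs_div, abs_mul, abs_zpow, abs_neg, abs_one,
        one_zpow, one_mul, abs_of_pos (a := Real.pi * (a - k))
          (mul_pos Real.pi_pos (hna.trans_le hak))]
      have := Real.pi_pos
      gcongr
    · rw [Finset.sum_const, Int.card_Icc, nsmul_eq_mul]
      have : (2 * (m : ℤ) - n - 1 + 1 - -n).toNat = 2 * m := by omega
      rw [this]
      push_cast
      rfl
  have hmain := norm_sincSum_le_of_abs_le_half (d := a - m)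
    (abs_le.2 ⟨by linarith, by linarith⟩) (n - m) y
  rw [hsin] at hmain
  have hexp := Complex.norm_exp_ofReal_mul_I (m * y)
  push_cast at hexp
  rw [sincSum, hsplit, Finset.sum_union hdisj, sum_Icc_shift_eq_sincSum a n m hmn]
  refine (norm_add_le _ _).trans ?_
  rw [norm_mul, hexp, one_mul]
  have hna : (0 : ℝ) < n - a := by linarith
  have h3 : (2 * m) * (|Real.sin (Real.pi * a)| / (Real.pi * (n - a))) ≤
      (2 * (a + 1 / 2)) * (|Real.sin (Real.pi * a)| / (Real.pi * (n - a))) := by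
    have := Real.pi_pos
    gcongr
  refine (add_le_add (hrest.trans h3) hmain).trans (le_of_eq ?_)
  have := Real.pi_pos
  field_simp
  ring

/-! ### Spectral representation and the mean square error. -/

section

/-- The coefficients of the approximation error `X t - X_n t`. -/
noncomputable def errCoeff (ω t : ℝ) : Option ℤ → ℝ
  | none => 1
  | some k => -Real.sinc (ω * (t - (k : ℝ) * Real.pi / ω))

/-- The times entering the approximation error `X t - X_n t`. -/
noncomputable def errTime (ω t : ℝ) : Option ℤ → ℝ
  | none => t
  | some k => (k : ℝ) * Real.pi / ω

lemma sub_truncatedSeries_eq_sum {Ω : Type*} (X : ℝ → Ω → ℝ) (ω : ℝ) (n : ℕ) (t : ℝ) (w : Ω) :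
    X t w - truncatedSeries ω n X t w =
      ∑ i ∈ (Finset.Icc (-(n : ℤ)) n).insertNone, errCoeff ω t i * X (errTime ω t i) w := by
  simp [Finset.sum_insertNone, errCoeff, errTime, truncatedSeries, sub_eq_add_neg]

variable {Ω : Type*} [MeasurableSpace Ω] {P : Measure Ω} {X : ℝ → Ω → ℝ}

lemma IsStationaryProcess.integrable_mul (h : IsStationaryProcess P X) (s t : ℝ) :
    Integrable (fun w => X s w * X t w) P :=
  (h.memLp_two s).integrable_mul (h.memLp_two t)

lemma IsStationaryProcess.integral_mul_eq_covFun (h : IsStationaryProcess P X) (s t : ℝ) :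
    ∫ w, X s w * X t w ∂P = covFun P X (s - t) := by
  rw [covFun, ← h.shift_invariant (s - t) 0 t]
  simp

/-- The second moment of a finite linear combination of values of the process, in terms of the
spectral measure. -/
theorem integral_sq_sum_eq_integral_norm_sq (h : IsStationaryProcess P X) {F : Measure ℝ}
    (hF : IsSpectralMeasure P X F) {ι : Type*} (s : Finset ι) (c τ : ι → ℝ) :
    ∫ w, (∑ i ∈ s, c i * X (τ i) w) ^ 2 ∂P =
      ∫ l, ‖∑ i ∈ s, (c i : ℂ) * Complex.exp (τ i * l * Complex.I)‖ ^ 2 ∂F := by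
  have := hF.1
  have hL : ∫ w, (∑ i ∈ s, c i * X (τ i) w) ^ 2 ∂P =
      ∑ i ∈ s, ∑ j ∈ s, c i * c j * covFun P X (τ i - τ j) := by
    have e : ∀ w, (∑ i ∈ s, c i * X (τ i) w) ^ 2 =
        ∑ i ∈ s, ∑ j ∈ s, c i * c j * (X (τ i) w * X (τ j) w) := fun w => by
      rw [sq, Finset.sum_mul_sum]
      exact Finset.sum_congr rfl fun i _ => Finset.sum_congr rfl fun j _ => by ring
    simp_rw [e]
    rw [integral_finsetSum _ fun i _ => integrable_finsetSum _ fun j _ =>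
      (h.integrable_mul _ _).const_mul _]
    refine Finset.sum_congr rfl fun i _ => ?_
    rw [integral_finsetSum _ fun j _ => (h.integrable_mul _ _).const_mul _]
    refine Finset.sum_congr rfl fun j _ => ?_
    rw [integral_const_mul, h.integral_mul_eq_covFun]
  have hint : ∀ τ : ℝ, Integrable (fun l : ℝ => Complex.exp (Complex.I * (τ : ℂ) * (l : ℂ))) F := by
    intro τ
    refine Integrable.of_bound (by fun_prop) 1 (Eventually.of_forall fun l => ?_)
    have := Complex.norm_exp_ofReal_mul_I (τ * l)
    push_cast at this
    rw [mul_assoc, mul_comm, this]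
  rw [hL]
  apply Complex.ofReal_injective
  rw [← integral_complex_ofReal]
  have e : ∀ l : ℝ, ((‖∑ i ∈ s, (c i : ℂ) * Complex.exp (τ i * l * Complex.I)‖ ^ 2 : ℝ) : ℂ) =
      ∑ i ∈ s, ∑ j ∈ s, ((c i * c j : ℝ) : ℂ) *
        Complex.exp (Complex.I * ((τ i - τ j : ℝ) : ℂ) * (l : ℂ)) := fun l => by
    rw [Complex.ofReal_pow, ← Complex.mul_conj', map_sum, Finset.sum_mul_sum]
    refine Finset.sum_congr rfl fun i _ => Finset.sum_congr rfl fun j _ => ?_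
    rw [map_mul, ← Complex.exp_conj]
    simp only [map_mul, Complex.conj_ofReal, Complex.conj_I]
    rw [mul_mul_mul_comm, ← Complex.exp_add]
    push_cast
    congr 2
    ring
  simp_rw [e]
  rw [integral_finsetSum _ fun i _ => integrable_finsetSum _ fun j _ => (hint _).const_mul _]
  push_cast
  refine Finset.sum_congr rfl fun i _ => ?_
  rw [integral_finsetSum _ fun j _ => by simpa using (hint (τ i - τ j)).const_mul _]
  refine Finset.sum_congr rfl fun j _ => ?_
  rw [integral_const_mul, hF.2]
  push_cast
  rfl

lemma covFun_zero_eq {F : Measure ℝ}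
    (hF : IsSpectralMeasure P X F) : covFun P X 0 = F.real Set.univ := by
  have := hF.1
  have h := hF.2 0
  simp only [Complex.ofReal_zero, mul_zero, zero_mul, Complex.exp_zero, integral_const] at h
  simpa using h

lemma sum_errCoeff_exp {ω : ℝ} (hω : 0 < ω) (n : ℕ) (t l : ℝ) :
    ∑ i ∈ (Finset.Icc (-(n : ℤ)) n).insertNone,
      (errCoeff ω t i : ℂ) * Complex.exp (errTime ω t i * l * Complex.I) =
      Complex.exp ((ω * t / Real.pi : ℝ) * (Real.pi * l / ω : ℝ) * Complex.I) -
        sincSum (ω * t / Real.pi) n (Real.pi * l / ω) := by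
  have hpi := Real.pi_pos
  have h1 : (ω : ℂ) ≠ 0 := by exact_mod_cast hω.ne'
  have h2 : (Real.pi : ℂ) ≠ 0 := by exact_mod_cast hpi.ne'
  simp only [Finset.sum_insertNone, errCoeff, errTime, sincSum]
  rw [sub_eq_add_neg, ← Finset.sum_neg_distrib]
  congr 1
  · rw [Complex.ofReal_one, one_mul]
    congr 1
    push_cast
    field_simp
  · refine Finset.sum_congr rfl fun k _ => ?_
    have e : ω * (t - (k : ℝ) * Real.pi / ω) = Real.pi * (ω * t / Real.pi - k) := by field_simp
    rw [e, Complex.ofReal_neg, neg_mul]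
    congr 3
    push_cast
    field_simp

lemma Dn_nonneg {ω t : ℝ} {n : ℕ} (h0 : 0 ≤ ω * t / Real.pi) (hn : ω * t / Real.pi < n) :
    0 ≤ Dn ω n t := by
  have := pi_div_two_le_Si_pi
  have hpi := Real.pi_pos
  have : 0 ≤ Si Real.pi := by linarith
  have : 0 < (n : ℝ) - ω * t / Real.pi := by linarith
  unfold Dn
  positivity

lemma norm_exp_sub_sincSum_le_Dn {ω t : ℝ} {n : ℕ} (h0 : 0 ≤ ω * t / Real.pi)
    (hn : ω * t / Real.pi < n) (y : ℝ) :
    ‖Complex.exp ((ω * t / Real.pi : ℝ) * y * Complex.I) - sincSum (ω * t / Real.pi) n y‖ ≤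
      Dn ω n t := by
  have h := norm_sincSum_le h0 hn y
  rw [mul_div_cancel₀ (ω * t) Real.pi_ne_zero] at h
  have hexp := Complex.norm_exp_ofReal_mul_I (ω * t / Real.pi * y)
  rw [Complex.ofReal_mul] at hexp
  refine (norm_sub_le _ _).trans ?_
  rw [hexp, Dn]
  linarith

/-- The bound for the truncation error inside the band. -/
noncomputable def bandBound (ω Λ z : ℝ) (n : ℕ) (t : ℝ) : ℝ :=
  4 * ω * t / (Real.pi ^ 2 * (1 - z))
    + 4 * (z + 1 + 1 / (n : ℝ)) / (Real.pi * (1 - z) ^ 2 * (1 - Λ / ω))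

lemma bandBound_pos {ω Λ z t : ℝ} {n : ℕ} (hΛ : 0 < Λ) (hΛω : Λ < ω) (hz0 : 0 < z) (hz1 : z < 1)
    (ht : 0 ≤ t) : 0 < bandBound ω Λ z n t := by
  have hω : 0 < ω := hΛ.trans hΛω
  have h1 : 0 < 1 - z := by linarith
  have h2 : 0 < 1 - Λ / ω := by rw [sub_pos, div_lt_one hω]; exact hΛω
  have := Real.pi_pos
  unfold bandBound
  positivity

lemma norm_exp_sub_sincSum_le_bandBound {ω Λ z t l : ℝ} {n : ℕ} (hΛ : 0 < Λ) (hΛω : Λ < ω)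
    (hz0 : 0 < z) (hz1 : z < 1) (ht : 0 ≤ t) (hn0 : 0 < n)
    (hn : ω * t / Real.pi ≤ n * Real.sqrt z) (hl : |l| ≤ Λ) :
    ‖Complex.exp ((ω * t / Real.pi : ℝ) * (Real.pi * l / ω : ℝ) * Complex.I) -
      sincSum (ω * t / Real.pi) n (Real.pi * l / ω)‖ ≤ bandBound ω Λ z n t / n := by
  have hω : 0 < ω := hΛ.trans hΛω
  have hpi := Real.pi_pos
  have hn0' : (0 : ℝ) < n := by exact_mod_cast hn0
  have h1 : 0 < 1 - z := by linarith
  have h2 : 0 < 1 - Λ / ω := by rw [sub_pos, div_lt_one hω]; exact hΛω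
  have hsz : Real.sqrt z < 1 := by rw [Real.sqrt_lt' one_pos]; simpa using hz1
  set a := ω * t / Real.pi with ha
  have ha0 : 0 ≤ a := by positivity
  have han : a < n := hn.trans_lt (by nlinarith)
  have ha2 : a ^ 2 ≤ n ^ 2 * z := by
    have := mul_self_le_mul_self ha0 hn
    calc a ^ 2 = a * a := sq a
      _ ≤ _ := this
      _ = n ^ 2 * (Real.sqrt z * Real.sqrt z) := by ring
      _ = n ^ 2 * z := by rw [Real.mul_self_sqrt hz0.le]
  have hy : |Real.pi * l / ω| = Real.pi * (|l| / ω) := by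
    rw [abs_div, abs_mul, abs_of_pos hpi, abs_of_pos hω, mul_div_assoc]
  have hlω : |l| / ω ≤ Λ / ω := by gcongr
  have hyπ : |Real.pi * l / ω| < Real.pi := by
    rw [hy]; nlinarith
  -- The cosine lies above its chord on `[0, π/2]`, which turns the Abel denominator into the factor
  -- `1 - Λ/ω`.
  have hcos : 1 - Λ / ω ≤ Real.cos (Real.pi * l / ω / 2) := by
    have h := Real.one_sub_mul_le_cos (x := |Real.pi * l / ω| / 2) (by positivity) (by linarith)
    rw [← abs_two (α := ℝ), ← abs_div, Real.cos_abs, abs_div, hy, abs_two] at h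
    have e : 2 / Real.pi * (Real.pi * (|l| / ω) / 2) = |l| / ω := by field_simp
    rw [e] at h
    linarith
  have hfrac : ((n : ℝ) + 1 + a)⁻¹ + (n + 1 - a)⁻¹ ≤ 2 / (n * (1 - z)) := by
    have hp : 0 < (n : ℝ) - a := by linarith
    calc ((n : ℝ) + 1 + a)⁻¹ + (n + 1 - a)⁻¹ ≤ (n + a)⁻¹ + (n - a)⁻¹ := by
          gcongr <;> linarith
      _ = 2 * n / (n ^ 2 - a ^ 2) := by
          have h3 : (n : ℝ) + a ≠ 0 := by positivity
          rw [sq_sub_sq]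
          field_simp
          ring
      _ ≤ 2 * n / (n ^ 2 * (1 - z)) := by
          gcongr
          linarith
      _ = 2 / (n * (1 - z)) := by field_simp
  have h := norm_exp_sub_sincSum_le (n := n) ha0 han hyπ
  refine h.trans ?_
  calc |Real.sin (Real.pi * a)| / Real.pi *
        ((((n : ℝ) + 1 + a)⁻¹ + (n + 1 - a)⁻¹) / Real.cos (Real.pi * l / ω / 2))
      ≤ 1 / Real.pi * (2 / (n * (1 - z)) / (1 - Λ / ω)) := by
        have hq : 0 < (n : ℝ) + 1 - a := by linarith
        have hc0 : 0 < Real.cos (Real.pi * l / ω / 2) := h2.trans_le hcos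
        have hc1 := Real.abs_sin_le_one (Real.pi * a)
        gcongr
    _ = (2 * (1 - z) / (Real.pi * (1 - z) ^ 2 * (1 - Λ / ω))) / n := by field_simp
    _ ≤ bandBound ω Λ z n t / n := by
        gcongr
        unfold bandBound
        have h5 : 0 ≤ 4 * ω * t / (Real.pi ^ 2 * (1 - z)) := by positivity
        -- The Abel bound is already below the second summand of `bandBound`; the first summand is
        -- only added as a nonnegative term.
        have h6 : 2 * (1 - z) / (Real.pi * (1 - z) ^ 2 * (1 - Λ / ω)) ≤
            4 * (z + 1 + 1 / (n : ℝ)) / (Real.pi * (1 - z) ^ 2 * (1 - Λ / ω)) := by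
          have : (0 : ℝ) ≤ 1 / n := by positivity
          refine div_le_div_of_nonneg_right ?_ (by positivity)
          linarith
        linarith

lemma An_eq {B0 ω Λ z t : ℝ} {n : ℕ} {F : Measure ℝ} (hB : 0 ≤ B0)
    (hb : 0 ≤ bandBound ω Λ z n t) :
    An B0 F ω Λ z n t = Real.sqrt B0 * (bandBound ω Λ z n t / n) +
      Dn ω n t * Real.sqrt (F.real {l : ℝ | Λ < |l|}) := by
  have e : Cn B0 ω Λ z n t = B0 * bandBound ω Λ z n t ^ 2 := rfl
  rw [An, e, Real.sqrt_mul hB, Real.sqrt_sq hb, mul_div_assoc]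

/-- The mean square error of the truncated series. -/
theorem integral_sq_error_le (h : IsStationaryProcess P X) {F : Measure ℝ}
    (hF : IsSpectralMeasure P X F) {ω Λ z t : ℝ} {n : ℕ} (hΛ : 0 < Λ) (hΛω : Λ < ω)
    (hz0 : 0 < z) (hz1 : z < 1) (ht : 0 ≤ t) (hn0 : 0 < n)
    (hn : ω * t / Real.pi ≤ n * Real.sqrt z) :
    ∫ w, (X t w - truncatedSeries ω n X t w) ^ 2 ∂P ≤
      An (covFun P X 0) F ω Λ z n t ^ 2 := by
  have hfin := hF.1
  have hω : 0 < ω := hΛ.trans hΛω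
  have hn0' : (0 : ℝ) < n := by exact_mod_cast hn0
  have hsz : Real.sqrt z < 1 := by rw [Real.sqrt_lt' one_pos]; simpa using hz1
  have ha0 : 0 ≤ ω * t / Real.pi := by have := Real.pi_pos; positivity
  have han : ω * t / Real.pi < n := hn.trans_lt (by nlinarith)
  have hb := (bandBound_pos (n := n) hΛ hΛω hz0 hz1 ht).le
  have hD := Dn_nonneg ha0 han
  have hS : MeasurableSet {l : ℝ | Λ < |l|} := measurableSet_lt measurable_const measurable_norm
  have hB : covFun P X 0 = F.real Set.univ := covFun_zero_eq hF
  simp_rw [sub_truncatedSeries_eq_sum]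
  rw [integral_sq_sum_eq_integral_norm_sq h hF]
  simp_rw [sum_errCoeff_exp hω]
  have hint : Integrable (fun l => (bandBound ω Λ z n t / n) ^ 2 +
      Set.indicator {l : ℝ | Λ < |l|} (fun _ => Dn ω n t ^ 2) l) F :=
    (integrable_const _).add ((integrable_const _).indicator hS)
  refine (integral_mono_of_nonneg (Eventually.of_forall fun l => by positivity) hint
    (Eventually.of_forall fun l => ?_)).trans ?_
  · by_cases hl : Λ < |l|
    · simp only [Set.indicator_of_mem (show l ∈ {l : ℝ | Λ < |l|} from hl)]
      have := pow_le_pow_left₀ (norm_nonneg _)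
        (norm_exp_sub_sincSum_le_Dn ha0 han (Real.pi * l / ω)) 2
      exact this.trans (by linarith [sq_nonneg (bandBound ω Λ z n t / n)])
    · simp only [Set.indicator_of_notMem (show l ∉ {l : ℝ | Λ < |l|} from hl), add_zero]
      exact pow_le_pow_left₀ (norm_nonneg _) (norm_exp_sub_sincSum_le_bandBound hΛ hΛω hz0 hz1 ht
        hn0 hn (not_lt.1 hl)) 2
  · rw [integral_add (integrable_const _) ((integrable_const _).indicator hS),
      integral_indicator_const _ hS, integral_const, smul_eq_mul, smul_eq_mul,
      An_eq (by rw [hB]; positivity) hb, ← hB]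
    have h1 := Real.sq_sqrt (show 0 ≤ covFun P X 0 by rw [hB]; positivity)
    have h2 := Real.sq_sqrt (show 0 ≤ F.real {l : ℝ | Λ < |l|} by positivity)
    have h3 : 0 ≤ 2 * (Real.sqrt (covFun P X 0) * (bandBound ω Λ z n t / n)) *
      (Dn ω n t * Real.sqrt (F.real {l : ℝ | Λ < |l|})) := by positivity
    -- The two pieces of the spectral integral are the squares of the two summands of `An`; the
    -- nonnegative cross term is the slack.
    rw [add_sq, mul_pow, mul_pow, h1, h2]
    linarith

end

/-! ### Gaussian moments and a weighted Jensen inequality. -/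

section

variable {Ω : Type*} [MeasurableSpace Ω] {P : Measure Ω}

/-- This is `x ≤ exp(x - 1)` at `x = v/√s`, raised to the power `s`. With the rate `√s`, the
Gaussian exponential moment `exp(s/2)` cancels half of the factor `exp(-s)`. -/
lemma rpow_le_mul_exp {s v : ℝ} (hs : 0 < s) (hv : 0 ≤ v) :
    v ^ s ≤ (s ^ (s / 2) * Real.exp (-s)) * Real.exp (Real.sqrt s * v) := by
  have hq : 0 < Real.sqrt s := Real.sqrt_pos.2 hs
  have h1 : v / Real.sqrt s ≤ Real.exp (v / Real.sqrt s - 1) := by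
    have := Real.add_one_le_exp (v / Real.sqrt s - 1)
    linarith
  have h2 := Real.rpow_le_rpow (by positivity) h1 hs.le
  rw [← Real.exp_mul, Real.div_rpow hv hq.le, div_le_iff₀ (by positivity)] at h2
  have h3 : Real.sqrt s ^ s = s ^ (s / 2) := by
    rw [Real.sqrt_eq_rpow, ← Real.rpow_mul hs.le]; congr 1; ring
  have h4 : (v / Real.sqrt s - 1) * s = -s + Real.sqrt s * v := by
    have : s = Real.sqrt s * Real.sqrt s := (Real.mul_self_sqrt hs.le).symm
    field_simp
    nlinarith [this]
  rw [h3, h4, Real.exp_add] at h2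
  linarith

/-- The bound for the absolute moment of order `s` of a centred Gaussian variable with variance
at most one. -/
noncomputable def momentBound (s : ℝ) : ℝ := 2 * s ^ (s / 2) * Real.exp (-(s / 2))

lemma integral_exp_mul_le {Z : Ω → ℝ} (hZ : HasGaussianLaw Z P)
    (h0 : ∫ w, Z w ∂P = 0) {A : ℝ} (hA : 0 < A) (h2 : ∫ w, Z w ^ 2 ∂P ≤ A ^ 2) (c : ℝ) :
    Integrable (fun w => Real.exp (c / A * Z w)) P ∧
      ∫ w, Real.exp (c / A * Z w) ∂P ≤ Real.exp (c ^ 2 / 2) := by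
  have hmap := hZ.map_eq_gaussianReal
  have := hZ.isProbabilityMeasure
  constructor
  · have hi := integrable_exp_mul_gaussianReal (μ := ∫ w, Z w ∂P) (v := Var[Z; P].toNNReal) (c / A)
    rw [← hmap] at hi
    exact hi.comp_aemeasurable hZ.aemeasurable
  · have hm := mgf_gaussianReal hmap (c / A)
    rw [mgf] at hm
    rw [hm, h0, zero_mul, zero_add, Real.exp_le_exp, Real.coe_toNNReal _ (variance_nonneg _ _),
      variance_of_integral_eq_zero hZ.aemeasurable h0, div_pow]
    calc (∫ w, Z w ^ 2 ∂P) * (c ^ 2 / A ^ 2) / 2 ≤ A ^ 2 * (c ^ 2 / A ^ 2) / 2 := by gcongr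
      _ = c ^ 2 / 2 := by field_simp

lemma lintegral_abs_div_rpow_le {Z : Ω → ℝ} (hZ : HasGaussianLaw Z P)
    (h0 : ∫ w, Z w ∂P = 0) {A s : ℝ} (hA : 0 < A) (h2 : ∫ w, Z w ^ 2 ∂P ≤ A ^ 2) (hs : 0 < s) :
    ∫⁻ w, ENNReal.ofReal ((|Z w| / A) ^ s) ∂P ≤ ENNReal.ofReal (momentBound s) := by
  obtain ⟨i1, b1⟩ := integral_exp_mul_le hZ h0 hA h2 (Real.sqrt s)
  obtain ⟨i2, b2⟩ := integral_exp_mul_le hZ h0 hA h2 (-Real.sqrt s)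
  rw [neg_sq, Real.sq_sqrt hs.le] at b2
  rw [Real.sq_sqrt hs.le] at b1
  set K := s ^ (s / 2) * Real.exp (-s) with hK
  have hK0 : 0 < K := by positivity
  have hint : Integrable (fun w => K * (Real.exp (Real.sqrt s / A * Z w) +
      Real.exp (-Real.sqrt s / A * Z w))) P := (i1.add i2).const_mul K
  calc ∫⁻ w, ENNReal.ofReal ((|Z w| / A) ^ s) ∂P
      ≤ ∫⁻ w, ENNReal.ofReal (K * (Real.exp (Real.sqrt s / A * Z w) +
        Real.exp (-Real.sqrt s / A * Z w))) ∂P := by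
        refine lintegral_mono fun w => ENNReal.ofReal_le_ofReal ?_
        refine (rpow_le_mul_exp hs (by positivity)).trans ?_
        rw [← hK]
        refine mul_le_mul_of_nonneg_left ?_ hK0.le
        rcases abs_cases (Z w) with h | h
        · rw [h.1, show Real.sqrt s * (Z w / A) = Real.sqrt s / A * Z w by ring]
          linarith [Real.exp_pos (-Real.sqrt s / A * Z w)]
        · rw [h.1, show Real.sqrt s * (-Z w / A) = -Real.sqrt s / A * Z w by ring]
          linarith [Real.exp_pos (Real.sqrt s / A * Z w)]
    _ = ENNReal.ofReal (K * (∫ w, Real.exp (Real.sqrt s / A * Z w) ∂P +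
        ∫ w, Real.exp (-Real.sqrt s / A * Z w) ∂P)) := by
        rw [← ofReal_integral_eq_lintegral_ofReal hint (Eventually.of_forall fun w => by positivity),
          integral_const_mul, integral_add i1 i2]
    _ ≤ ENNReal.ofReal (momentBound s) := by
        refine ENNReal.ofReal_le_ofReal ?_
        have e : Real.exp (-s) * Real.exp (s / 2) = Real.exp (-(s / 2)) := by
          rw [← Real.exp_add]; congr 1; ring
        calc _ ≤ K * (Real.exp (s / 2) + Real.exp (s / 2)) := by gcongr
          _ = momentBound s := by rw [momentBound, ← e, hK]; ring

/-- Jensen's inequality for a weighted lower integral. -/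
lemma lintegral_mul_rpow_le {α : Type*} [MeasurableSpace α] {ν : Measure α} {a f : α → ENNReal}
    (ha : AEMeasurable a ν) (hf : AEMeasurable f ν) {u : ℝ} (hu : 1 ≤ u) :
    (∫⁻ x, a x * f x ∂ν) ^ u ≤ (∫⁻ x, a x ∂ν) ^ (u - 1) * ∫⁻ x, a x * f x ^ u ∂ν := by
  have hu0 : 0 < u := by linarith
  have hfa : AEMeasurable f (ν.withDensity a) := hf.mono_ac (withDensity_absolutelyContinuous _ _)
  -- Comparison of the norms of orders `1` and `u` for the measure with density `a`, whose total
  -- mass supplies the prefactor.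
  have h := eLpNorm'_le_eLpNorm'_mul_rpow_measure_univ one_pos hu hfa.aestronglyMeasurable
  simp only [eLpNorm'_eq_lintegral_enorm, enorm_eq_self, ENNReal.rpow_one, div_one] at h
  rw [withDensity_apply _ MeasurableSet.univ, Measure.restrict_univ,
    lintegral_withDensity_eq_lintegral_mul₀ ha hf,
    lintegral_withDensity_eq_lintegral_mul₀ ha (hf.pow_const u)] at h
  have h' := ENNReal.rpow_le_rpow h hu0.le
  rw [ENNReal.mul_rpow_of_nonneg _ _ hu0.le, ← ENNReal.rpow_mul, ← ENNReal.rpow_mul,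
    one_div_mul_cancel hu0.ne', ENNReal.rpow_one, sub_mul, one_mul,
    one_div_mul_cancel hu0.ne'] at h'
  simp only [Pi.mul_apply] at h'
  exact h'.trans_eq (mul_comm _ _)

end

/-! ### The tail estimate for the integral of the `p`-th power. -/

section

variable {Ω : Type*} [MeasurableSpace Ω] {P : Measure Ω}

/-- The maximum in the hypothesis is `M^(p/2)`. Raising to the power `M/p` produces `M^(M/2)`, which
cancels the growth of the moment bound, and `M ≥ 2 ln(2/δ)` makes the remaining `2 exp(-M/2)` at
most `δ`. -/
lemma momentBound_mul_rpow_le {S p ε δ : ℝ} (hS0 : 0 ≤ S) (hp : 1 ≤ p) (hε : 0 < ε) (hδ0 : 0 < δ)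
    (hδ1 : δ < 1)
    (hS : S < ε / max (p ^ (p / 2)) ((2 * Real.log (2 / δ)) ^ (p / 2))) :
    S ^ (max p (2 * Real.log (2 / δ)) / p) * momentBound (max p (2 * Real.log (2 / δ))) ≤
      ε ^ (max p (2 * Real.log (2 / δ)) / p) * δ := by
  have hp0 : 0 < p := by linarith
  have hlog : 0 < Real.log (2 / δ) := Real.log_pos (by rw [lt_div_iff₀ hδ0]; linarith)
  set M := max p (2 * Real.log (2 / δ)) with hM
  have hM0 : 0 < M := hp0.trans_le (le_max_left _ _)
  have hmax : M ^ (p / 2) = max (p ^ (p / 2)) ((2 * Real.log (2 / δ)) ^ (p / 2)) := by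
    rcases le_total p (2 * Real.log (2 / δ)) with h | h
    · rw [hM, max_eq_right h, max_eq_right (Real.rpow_le_rpow hp0.le h (by positivity))]
    · rw [hM, max_eq_left h, max_eq_left (Real.rpow_le_rpow (by positivity) h (by positivity))]
  rw [← hmax] at hS
  have h1 : S ^ (M / p) ≤ ε ^ (M / p) / M ^ (M / 2) := by
    refine (Real.rpow_le_rpow hS0 hS.le (by positivity)).trans (le_of_eq ?_)
    rw [Real.div_rpow hε.le (by positivity), ← Real.rpow_mul hM0.le]
    congr 2
    field_simp
  have h2 : 2 * Real.exp (-(M / 2)) ≤ δ := by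
    have : Real.log (2 / δ) ≤ M / 2 := by
      have := le_max_right p (2 * Real.log (2 / δ))
      rw [← hM] at this
      linarith
    have h3 : Real.exp (-(M / 2)) ≤ Real.exp (-Real.log (2 / δ)) := Real.exp_le_exp.2 (by linarith)
    rw [Real.exp_neg (Real.log _), Real.exp_log (by positivity), inv_div] at h3
    linarith
  calc S ^ (M / p) * momentBound M ≤ ε ^ (M / p) / M ^ (M / 2) * momentBound M := by
        have : 0 ≤ momentBound M := by unfold momentBound; positivity
        gcongr
    _ = ε ^ (M / p) * (2 * Real.exp (-(M / 2))) := by unfold momentBound; field_simp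
    _ ≤ ε ^ (M / p) * δ := by gcongr

/-- The tail of the `p`-th power integral of a Gaussian process with a bound on its mean square. -/
theorem gaussian_integral_rpow_tail [IsProbabilityMeasure P] {Z : ℝ → Ω → ℝ} {A : ℝ → ℝ}
    {T p ε δ : ℝ} (hT : 0 < T)
    (hZm : AEMeasurable (fun q : ℝ × Ω => Z q.1 q.2) ((volume : Measure ℝ).prod P))
    (hZ : ∀ t, HasGaussianLaw (Z t) P) (hZ0 : ∀ t, ∫ w, Z t w ∂P = 0)
    (hA : ContinuousOn A (Set.Icc 0 T)) (hA0 : ∀ t ∈ Set.Icc 0 T, 0 < A t)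
    (hZA : ∀ t ∈ Set.Icc 0 T, ∫ w, Z t w ^ 2 ∂P ≤ A t ^ 2)
    (hp : 1 ≤ p) (hε : 0 < ε) (hδ0 : 0 < δ) (hδ1 : δ < 1)
    (hS : ∫ t in (0 : ℝ)..T, A t ^ p <
      ε / max (p ^ (p / 2)) ((2 * Real.log (2 / δ)) ^ (p / 2))) :
    (∀ᵐ w ∂P, IntervalIntegrable (fun t => |Z t w| ^ p) volume 0 T) ∧
      P.real {w | ε < ∫ t in (0 : ℝ)..T, |Z t w| ^ p} ≤ δ := by
  have hp0 : 0 < p := by linarith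
  have hlog : 0 < Real.log (2 / δ) := Real.log_pos (by rw [lt_div_iff₀ hδ0]; linarith)
  set M := max p (2 * Real.log (2 / δ)) with hM
  have hM0 : 0 < M := hp0.trans_le (le_max_left _ _)
  set u := M / p with hu
  have hu1 : 1 ≤ u := by rw [hu, one_le_div hp0]; exact le_max_left _ _
  have hu0 : 0 < u := by linarith
  set ν := (volume : Measure ℝ).restrict (Set.Ioc 0 T) with hν
  have hmem : ∀ᵐ t ∂ν, t ∈ Set.Icc 0 T :=
    (ae_restrict_mem measurableSet_Ioc).mono fun t ht => Set.Ioc_subset_Icc_self ht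
  have hAm : AEMeasurable A ν :=
    ((hA.mono Set.Ioc_subset_Icc_self).aestronglyMeasurable measurableSet_Ioc).aemeasurable
  have hZν : AEMeasurable (fun q : ℝ × Ω => Z q.1 q.2) (ν.prod P) :=
    hZm.mono_ac (Measure.AbsolutelyContinuous.prod Measure.absolutelyContinuous_restrict
      Measure.AbsolutelyContinuous.rfl)
  set a : ℝ → ENNReal := fun t => ENNReal.ofReal (A t ^ p) with ha
  set f : ℝ → Ω → ENNReal := fun t w => ENNReal.ofReal ((|Z t w| / A t) ^ p) with hf
  have ham : AEMeasurable a ν := (hAm.pow_const p).ennreal_ofReal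
  have hAfst : AEMeasurable (fun q : ℝ × Ω => A q.1) (ν.prod P) :=
    hAm.comp_quasiMeasurePreserving Measure.quasiMeasurePreserving_fst
  have hafst : AEMeasurable (fun q : ℝ × Ω => a q.1) (ν.prod P) :=
    ham.comp_quasiMeasurePreserving Measure.quasiMeasurePreserving_fst
  have hfm : AEMeasurable (Function.uncurry f) (ν.prod P) :=
    ((hZν.abs.div hAfst).pow_const p).ennreal_ofReal
  have hslice : ∀ᵐ w ∂P, AEMeasurable (fun t => Z t w) ν := by
    filter_upwards [hZν.prod_swap.aestronglyMeasurable.prodMk_left] with w hw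
    exact hw.aemeasurable
  have hfslice : ∀ᵐ w ∂P, AEMeasurable (fun t => f t w) ν := by
    filter_upwards [hslice] with w hw
    exact ((hw.abs.div hAm).pow_const p).ennreal_ofReal
  have haf : ∀ w, ∫⁻ t, a t * f t w ∂ν = ∫⁻ t, ENNReal.ofReal (|Z t w| ^ p) ∂ν := fun w => by
    refine lintegral_congr_ae (hmem.mono fun t ht => ?_)
    have hAt := hA0 t ht
    simp only [ha, hf]
    rw [← ENNReal.ofReal_mul (by positivity), ← Real.mul_rpow hAt.le (by positivity),
      mul_div_cancel₀ _ hAt.ne']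
  have hApint : IntegrableOn (fun t => A t ^ p) (Set.Ioc 0 T) :=
    ((hA.rpow_const fun t ht => Or.inl (hA0 t ht).ne').integrableOn_Icc).mono_set
      Set.Ioc_subset_Icc_self
  set S := ∫ t in (0 : ℝ)..T, A t ^ p with hSdef
  have hS0 : 0 ≤ S := intervalIntegral.integral_nonneg hT.le fun t ht => by
    have := hA0 t ht; positivity
  have haS : ∫⁻ t, a t ∂ν = ENNReal.ofReal S := by
    rw [hSdef, intervalIntegral.integral_of_le hT.le, ofReal_integral_eq_lintegral_ofReal hApint]
    exact hmem.mono fun t ht => by have := hA0 t ht; simp only [Pi.zero_apply]; positivity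
  set K := momentBound M with hK
  have hK0 : 0 ≤ K := by rw [hK, momentBound]; positivity
  have hfu : ∀ t ∈ Set.Icc 0 T, ∫⁻ w, f t w ^ u ∂P ≤ ENNReal.ofReal K := by
    intro t ht
    have hAt := hA0 t ht
    refine le_of_eq_of_le (lintegral_congr fun w => ?_)
      (lintegral_abs_div_rpow_le (hZ t) (hZ0 t) hAt (hZA t ht) hM0)
    simp only [hf]
    rw [ENNReal.ofReal_rpow_of_nonneg (by positivity) hu0.le, ← Real.rpow_mul (by positivity), hu,
      mul_div_cancel₀ _ hp0.ne']
  -- Jensen in `t` with weight `A^p` of mass `S` moves the power `u` onto `f`; after Tonelli the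
  -- inner expectation is a normalised absolute moment of order `pu = M`.
  have hmoment : ∫⁻ w, (∫⁻ t, a t * f t w ∂ν) ^ u ∂P ≤
      ENNReal.ofReal S ^ u * ENNReal.ofReal K := by
    calc ∫⁻ w, (∫⁻ t, a t * f t w ∂ν) ^ u ∂P
        ≤ ∫⁻ w, ENNReal.ofReal S ^ (u - 1) * ∫⁻ t, a t * f t w ^ u ∂ν ∂P := by
          refine lintegral_mono_ae (hfslice.mono fun w hw => ?_)
          rw [← haS]
          exact lintegral_mul_rpow_le ham hw hu1
      _ = ENNReal.ofReal S ^ (u - 1) * ∫⁻ w, ∫⁻ t, a t * f t w ^ u ∂ν ∂P :=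
          lintegral_const_mul' _ _ (ENNReal.rpow_ne_top_of_nonneg (by linarith)
            ENNReal.ofReal_ne_top)
      _ = ENNReal.ofReal S ^ (u - 1) * ∫⁻ t, ∫⁻ w, a t * f t w ^ u ∂P ∂ν := by
          rw [lintegral_lintegral_swap (f := fun t w => a t * f t w ^ u)
            (hafst.mul (hfm.pow_const u))]
      _ ≤ ENNReal.ofReal S ^ (u - 1) * ∫⁻ t, a t * ENNReal.ofReal K ∂ν := by
          refine mul_le_mul' le_rfl (lintegral_mono_ae (hmem.mono fun t ht => ?_))
          rw [lintegral_const_mul' _ _ ENNReal.ofReal_ne_top]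
          gcongr
          exact hfu t ht
      _ = ENNReal.ofReal S ^ u * ENNReal.ofReal K := by
          rw [lintegral_mul_const' _ _ ENNReal.ofReal_ne_top, haS, ← mul_assoc]
          congr 1
          conv_lhs => rw [← ENNReal.rpow_one (ENNReal.ofReal S), ← ENNReal.rpow_mul, one_mul,
            ← ENNReal.rpow_add_of_nonneg _ _ (by linarith) zero_le_one]
          congr 1
          ring
  have hYm : AEMeasurable (fun w => (∫⁻ t, a t * f t w ∂ν) ^ u) P :=
    (AEMeasurable.lintegral_prod_left (f := fun t w => a t * f t w)
      (hafst.mul hfm)).pow_const u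
  have hfinite : ∀ᵐ w ∂P, ∫⁻ t, ENNReal.ofReal (|Z t w| ^ p) ∂ν < ⊤ := by
    have hlt : ∫⁻ w, (∫⁻ t, a t * f t w ∂ν) ^ u ∂P ≠ ⊤ :=
      ne_top_of_le_ne_top (ENNReal.mul_ne_top (ENNReal.rpow_ne_top_of_nonneg hu0.le
        ENNReal.ofReal_ne_top) ENNReal.ofReal_ne_top) hmoment
    filter_upwards [ae_lt_top' hYm hlt] with w hw
    rw [← haf]
    exact (ENNReal.rpow_lt_top_iff_of_pos hu0).1 hw
  refine ⟨?_, ?_⟩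
  · filter_upwards [hslice, hfinite] with w hw hw'
    rw [intervalIntegrable_iff_integrableOn_Ioc_of_le hT.le]
    refine ⟨(hw.abs.pow_const p).aestronglyMeasurable, ?_⟩
    rw [hasFiniteIntegral_iff_ofReal (Eventually.of_forall fun t => by positivity)]
    exact hw'
  · have hsub : {w | ε < ∫ t in (0 : ℝ)..T, |Z t w| ^ p} ⊆
        {w | ENNReal.ofReal ε ^ u ≤ (∫⁻ t, a t * f t w ∂ν) ^ u} := by
      intro w hw
      rw [Set.mem_ofPred_eq, intervalIntegral.integral_of_le hT.le] at hw
      -- A path with a non-integrable power has integral `0` by convention, so it cannot exceed `ε`.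
      have hi : Integrable (fun t => |Z t w| ^ p) ν := by
        by_contra h
        rw [integral_undef h] at hw
        linarith
      rw [Set.mem_ofPred_eq, haf, ← ofReal_integral_eq_lintegral_ofReal hi
        (Eventually.of_forall fun t => by positivity)]
      exact ENNReal.rpow_le_rpow (ENNReal.ofReal_le_ofReal hw.le) hu0.le
    have hmarkov := mul_meas_ge_le_lintegral₀ hYm (ENNReal.ofReal ε ^ u)
    have hle : ENNReal.ofReal ε ^ u * P {w | ε < ∫ t in (0 : ℝ)..T, |Z t w| ^ p} ≤
        ENNReal.ofReal ε ^ u * ENNReal.ofReal δ := by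
      refine ((mul_le_mul_right (measure_mono hsub) _).trans (hmarkov.trans hmoment)).trans ?_
      rw [ENNReal.ofReal_rpow_of_nonneg hS0 hu0.le, ENNReal.ofReal_rpow_of_nonneg hε.le hu0.le,
        ← ENNReal.ofReal_mul (by positivity), ← ENNReal.ofReal_mul (by positivity)]
      exact ENNReal.ofReal_le_ofReal (momentBound_mul_rpow_le hS0 hp hε hδ0 hδ1 hS)
    have hε0 : ENNReal.ofReal ε ^ u ≠ 0 := by
      rw [ENNReal.ofReal_rpow_of_pos hε]
      exact (ENNReal.ofReal_pos.2 (by positivity)).ne'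
    rw [ENNReal.mul_le_mul_iff_right hε0 (ENNReal.rpow_ne_top_of_nonneg hu0.le
      ENNReal.ofReal_ne_top)] at hle
    exact ENNReal.toReal_le_of_le_ofReal hδ0.le hle

variable {X : ℝ → Ω → ℝ}

lemma hasGaussianLaw_error (hX : IsGaussianProcess X P) (ω : ℝ) (n : ℕ) (t : ℝ) :
    HasGaussianLaw (fun w => X t w - truncatedSeries ω n X t w) P := by
  simp_rw [sub_truncatedSeries_eq_sum]
  exact ((hX.comp_right (errTime ω t)).smul (errCoeff ω t)).hasGaussianLaw_fun_sum

lemma integral_error_eq_zero [IsFiniteMeasure P] (h : IsStationaryProcess P X) (ω : ℝ) (n : ℕ)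
    (t : ℝ) : ∫ w, (X t w - truncatedSeries ω n X t w) ∂P = 0 := by
  simp_rw [sub_truncatedSeries_eq_sum]
  rw [integral_finsetSum _ fun i _ =>
    ((h.memLp_two _).integrable one_le_two).const_mul _]
  simp [integral_const_mul, h.mean_zero]

lemma aemeasurable_error [SFinite P] (h : IsStationaryProcess P X)
    (hMeas : AEMeasurable (fun q : ℝ × Ω => X q.1 q.2) ((volume : Measure ℝ).prod P))
    (ω : ℝ) (n : ℕ) :
    AEMeasurable (fun q : ℝ × Ω => X q.1 q.2 - truncatedSeries ω n X q.1 q.2)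
      ((volume : Measure ℝ).prod P) := by
  refine hMeas.sub (Finset.aemeasurable_fun_sum _ fun k _ => AEMeasurable.mul ?_ ?_)
  · have hc : Continuous fun t : ℝ => Real.sinc (ω * (t - (k : ℝ) * Real.pi / ω)) :=
      Real.continuous_sinc.comp (by fun_prop)
    exact (hc.measurable.comp measurable_fst).aemeasurable
  · exact (h.memLp_two _).1.aemeasurable.comp_quasiMeasurePreserving
      Measure.quasiMeasurePreserving_snd

lemma continuousOn_An {B0 ω Λ z T : ℝ} {n : ℕ} {F : Measure ℝ}
    (hn : ∀ t ∈ Set.Icc 0 T, ω * t / Real.pi < n) :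
    ContinuousOn (An B0 F ω Λ z n) (Set.Icc 0 T) := by
  unfold An Cn Dn
  refine ContinuousOn.add (by fun_prop) (ContinuousOn.mul (ContinuousOn.add (by fun_prop)
    (ContinuousOn.mul (by fun_prop) (ContinuousOn.add (by fun_prop)
      (ContinuousOn.div (by fun_prop) (by fun_prop) fun t ht => ?_)))) (by fun_prop))
  linarith [hn t ht]

end

end SincApprox

/-! ### Combination of the mean square bound with the tail estimate. -/

theorem corollary3 {Ω : Type*} [MeasurableSpace Ω] (P : Measure Ω) [IsProbabilityMeasure P]
    (X : ℝ → Ω → ℝ)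
    (hGauss : IsGaussianProcess X P)
    (hStat : SincApprox.IsStationaryProcess P X)
    (hMeas : AEMeasurable (fun q : ℝ × Ω => X q.1 q.2) ((volume : Measure ℝ).prod P))
    (F : Measure ℝ) (hF : SincApprox.IsSpectralMeasure P X F)
    (ω Λ z T p ε δ : ℝ) (n : ℕ)
    (hΛ : 0 < Λ) (hΛω : Λ < ω) (hz0 : 0 < z) (hz1 : z < 1) (hT : 0 < T)
    (hn : ω * T / (Real.pi * Real.sqrt z) ≤ (n : ℝ))
    (hp : 1 ≤ p) (hε : 0 < ε) (hδ0 : 0 < δ) (hδ1 : δ < 1)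
    (hS : SincApprox.Snp (SincApprox.covFun P X 0) F ω Λ z n p T
      < ε / max (p ^ (p / 2)) ((2 * Real.log (2 / δ)) ^ (p / 2))) :
    SincApprox.ApproximatesInLp P X (SincApprox.truncatedSeries ω n X) p T ε δ := by
  have hfin := hF.1
  have hω : 0 < ω := hΛ.trans hΛω
  have hpi := Real.pi_pos
  have hp0 : 0 < p := by linarith
  have hsz0 : 0 < Real.sqrt z := Real.sqrt_pos.2 hz0
  have hsz1 : Real.sqrt z < 1 := by rw [Real.sqrt_lt' one_pos]; simpa using hz1
  have hn0' : (0 : ℝ) < n := lt_of_lt_of_le (by positivity) hn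
  have hn0 : 0 < n := by exact_mod_cast hn0'
  have hnt : ∀ t ∈ Set.Icc 0 T, ω * t / Real.pi ≤ n * Real.sqrt z := fun t ht => by
    have h1 : ω * t / Real.pi ≤ ω * T / Real.pi := by gcongr; exact ht.2
    have h2 : ω * T / (Real.pi * Real.sqrt z) * Real.sqrt z = ω * T / Real.pi := by field_simp
    have h3 := mul_le_mul_of_nonneg_right hn hsz0.le
    linarith
  have hnt' : ∀ t ∈ Set.Icc 0 T, ω * t / Real.pi < n := fun t ht =>
    (hnt t ht).trans_lt (by nlinarith)
  have hB := SincApprox.covFun_zero_eq hF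
  have hB0 : 0 ≤ SincApprox.covFun P X 0 := by rw [hB]; positivity
  have herr : ∀ t ∈ Set.Icc 0 T, ∫ w, (X t w - SincApprox.truncatedSeries ω n X t w) ^ 2 ∂P ≤
      SincApprox.An (SincApprox.covFun P X 0) F ω Λ z n t ^ 2 := fun t ht =>
    SincApprox.integral_sq_error_le hStat hF hΛ hΛω hz0 hz1 ht.1 hn0 (hnt t ht)
  have hmain := fun A => SincApprox.gaussian_integral_rpow_tail (A := A)
    (Z := fun t w => X t w - SincApprox.truncatedSeries ω n X t w) (P := P) (p := p) (ε := ε)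
    (δ := δ) hT (SincApprox.aemeasurable_error hStat hMeas ω n)
    (SincApprox.hasGaussianLaw_error hGauss ω n) (SincApprox.integral_error_eq_zero hStat ω n)
  have hAn : ∀ t ∈ Set.Icc 0 T, SincApprox.An (SincApprox.covFun P X 0) F ω Λ z n t =
      Real.sqrt (SincApprox.covFun P X 0) * (SincApprox.bandBound ω Λ z n t / n) +
      SincApprox.Dn ω n t * Real.sqrt (F.real {l : ℝ | Λ < |l|}) := fun t ht =>
    SincApprox.An_eq hB0 (SincApprox.bandBound_pos hΛ hΛω hz0 hz1 ht.1).le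
  have hDn : ∀ t ∈ Set.Icc 0 T, 0 ≤ SincApprox.Dn ω n t := fun t ht =>
    SincApprox.Dn_nonneg (div_nonneg (mul_nonneg hω.le ht.1) hpi.le) (hnt' t ht)
  -- The tail estimate divides by `A`, so it needs `A > 0`. If `B(0) = 0`, then `F` has mass zero
  -- and the error has zero mean square on `[0, T]`. `An` is then replaced by a positive constant
  -- whose `p`-th power integrates to half the allowed threshold.
  rcases hB0.eq_or_lt with h0 | h0
  · have hlog : 0 < Real.log (2 / δ) := Real.log_pos (by rw [lt_div_iff₀ hδ0]; linarith)
    set R := ε / max (p ^ (p / 2)) ((2 * Real.log (2 / δ)) ^ (p / 2)) with hR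
    have hR0 : 0 < R := div_pos hε (lt_max_of_lt_left (by positivity))
    have hc0 : 0 < (R / (2 * T)) ^ p⁻¹ := by positivity
    refine hmain (fun _ => (R / (2 * T)) ^ p⁻¹) continuousOn_const (fun _ _ => hc0)
      (fun t ht => ?_) hp hε hδ0 hδ1 ?_
    · have hF0 : F.real {l : ℝ | Λ < |l|} = 0 :=
        le_antisymm ((measureReal_mono (Set.subset_univ _)).trans (by rw [← hB, ← h0]))
          measureReal_nonneg
      have h1 := herr t ht
      rw [hAn t ht, hF0, ← h0] at h1
      simp only [Real.sqrt_zero, zero_mul, mul_zero, add_zero] at h1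
      exact h1.trans (by norm_num; positivity)
    · rw [intervalIntegral.integral_const, ← Real.rpow_mul (by positivity),
        inv_mul_cancel₀ hp0.ne', Real.rpow_one, sub_zero, smul_eq_mul]
      have : T * (R / (2 * T)) = R / 2 := by field_simp
      linarith
  · refine hmain _ (SincApprox.continuousOn_An hnt') (fun t ht => ?_) herr hp hε hδ0 hδ1 hS
    have hb := SincApprox.bandBound_pos (n := n) hΛ hΛω hz0 hz1 ht.1
    have hd := hDn t ht
    rw [hAn t ht]
    have := Real.sqrt_pos.2 h0
    positivity
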